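/- **Tracts.** A *tract* is a commutative multiplicative monoid $F$ with an absorbing element $0$ such that $F^\times=F\setminus\{0\}$ is a group, together with an ideal $N_F$ (the *null set*) of the group semiring $F^+=\mathbb N[F^\times]$ such that for every $a\in F$ there is a unique $b=:-a\in F$ with $a+b\in N_F$ (where $0\in F$ is identified with the empty sum). A *morphism* of tracts is a multiplicative map that preserves $0$, $1$ and the null sets. Let $\mathbb F_1^\pm=\{0,1,-1\}$ be the tract whose null set is $\{n.1+n.(-1)\mid n\in\mathbb N\}$, and let $\mathbb F_1^\pm(x_i\mid i\in I)$ be the free tract consisting of $0$ and all $\pm\prod x_i^{e_i}$ with $(e_i)\in\bigoplus_I\mathbb Z$, whose null set is generated by $1+(-1)$. For a set $S\subseteq F^+$ that contains no element of $F^\times$, the quotient $F/\!\!/\langle S\rangle$ is the quotient monoid of $F$ by the congruence generated by $a\sim b$ for all $a,b\in F$ with $a+(-b)\in S$; its null set is the ideal generated by the images of $N_F$ and $S$. **Universal tract and universal pasture.** Let $J$ be a (discrete) polymatroid of rank $r$ on $[n]$, given by its bases, i.e. a nonempty set $J\subseteq\{\alpha\in\mathbb N^n\mid \sum\alpha_i=r\}$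 such that for all $\alpha,\beta\in J$ and $i$ with $\alpha_i<\beta_i$ there is a $j$ with $\alpha_j>\beta_j$ and $\alpha+\epsilon_i-\epsilon_j,\ \beta-\epsilon_i+\epsilon_j\in J$. Let $\delta^-=\inf J$, $\delta^+=\sup J$ (componentwise), $\omega=\delta^+-\delta^-$ and $\bar r=r-\sum_i\delta^-_i$. For a tuple $\beta$ with entries in $[n]$ put $\Sigma\beta=\sum_m\epsilon_{\beta_m}$, and let $\mathbf J=\{\beta\in[n]^{\bar r}\mid \Sigma\beta+\delta^-\in J\}$. In $\mathbb F_1^\pm(x_\beta\mid\beta\in\mathbf J)$ put $x_\beta=0$ for $\beta\in[n]^{\bar r}\setminus\mathbf J$. Consider * (A) the alternating relations $x_{\beta\circ\sigma}-\operatorname{sign}(\sigma)\,x_\beta$ for $\beta\in[n]^{\bar r}$ and $\sigma\in S_{\bar r}$; * (P) the Plücker relations $\sum_{k=0}^s(-1)^k\,x_{\alpha i_0\cdots\widehat{i_k}\cdots i_s}\,x_{\alpha i_kj_2\cdots j_s}$ for $2\le s\le\bar r$, $\alpha\in[n]^{\bar r-s}$ and $i_0,\dots,i_s,j_2,\dots,j_s\in[n]$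 with $\Sigma(\alpha i_0\cdots i_sj_2\cdots j_s)\le\omega$; * (P3) the $3$-term Plücker relations $x_{\alpha ij}x_{\alpha kl}-x_{\alpha ik}x_{\alpha jl}+x_{\alpha il}x_{\alpha jk}$ for $\alpha\in[n]^{\bar r-2}$ and $i,j,k,l\in[n]$ with $\Sigma(\alpha ijkl)\le\omega$ (the case $s=2$ of (P)). The *extended universal tract* $\widehat T_J$ is the quotient of $\mathbb F_1^\pm(x_\beta\mid\beta\in\mathbf J)$ by (A) and (P), and the *extended universal pasture* $\widehat P_J$ is its quotient by (A) and (P3). Both are graded by $\deg x_\beta=1$ for $\beta\in\mathbf J$ (with $\deg 0=0$); the *universal tract* $T_J\subseteq\widehat T_J$ and the *universal pasture* $P_J\subseteq\widehat P_J$ are the subtracts of all elements of degree $0$ (a formal sum in a subtract is null if it is null in the ambient tract). Let $\hat\pi_J\colon\widehat P_J\to\widehat T_J$ be the canonical (degree preserving) morphism $[a]\mapsto[a]$, and $\pi_J\colon P_J\to T_J$ its restriction. **Theorem I.** For every polymatroid $J$, the canonical morphisms $\hat\pi_J\colon\widehat P_J\to\widehat T_J$ and $\pi_J\colon P_J\to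 T_J$ are bijections. -/

import Mathlib

universe u v

/-! ### Formal sums -/

/-- The ambient semiring `F⁺ = ℕ[Fˣ]` of a pointed abelian group `F`. -/
abbrev AmbientSemiring (F : Type u) [CommGroupWithZero F] : Type u :=
  MonoidAlgebra ℕ Fˣ

open Classical in
/-- The embedding `F → F⁺`, sending `0` to the empty sum and `a ≠ 0` to `1.a`. -/
noncomputable def formal {F : Type u} [CommGroupWithZero F] (a : F) : AmbientSemiring F :=
  if h : a = 0 then 0 else MonoidAlgebra.single (Units.mk0 a h) 1

/-- The semiring homomorphism `∑ aᵢ ↦ ∑ f aᵢ` induced by a morphism of pointed groups. -/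
noncomputable def ambientMap {F : Type u} {G : Type v} [CommGroupWithZero F]
    [CommGroupWithZero G] (f : F →*₀ G) : AmbientSemiring F →+* AmbientSemiring G :=
  MonoidAlgebra.mapDomainRingHom ℕ (Units.map (f : F →* G))

section FormalSums

variable {F : Type u} {G : Type v} [CommGroupWithZero F] [CommGroupWithZero G]

theorem formal_zero : formal (0 : F) = 0 := by simp [formal]

theorem formal_unit (u : Fˣ) : formal (u : F) = MonoidAlgebra.single u 1 := by
  simp [formal]

theorem ambientMap_single (f : F →*₀ G) (u : Fˣ) (m : ℕ) :
    ambientMap f (MonoidAlgebra.single u m) =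
      MonoidAlgebra.single (Units.map (f : F →* G) u) m := by
  simp [ambientMap]

theorem ambientMap_formal (f : F →*₀ G) (a : F) : ambientMap f (formal a) = formal (f a) := by
  by_cases h : a = 0
  · simp [h, formal_zero]
  · obtain ⟨u, rfl⟩ : ∃ u : Fˣ, (u : F) = a := ⟨Units.mk0 a h, rfl⟩
    rw [formal_unit, ambientMap_single, ← formal_unit]
    rfl

theorem ambientMap_comp {H : Type*} [CommGroupWithZero H] (f : F →*₀ G) (g : G →*₀ H)
    (x : AmbientSemiring F) : ambientMap g (ambientMap f x) = ambientMap (g.comp f) x := by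
  induction x using MonoidAlgebra.induction_linear with
  | zero => simp
  | add x y hx hy => simp only [map_add, hx, hy]
  | single u m =>
    rw [ambientMap_single, ambientMap_single, ambientMap_single]
    rfl

/-- The number of terms of a formal sum. -/
noncomputable def formalSize : AmbientSemiring F →+* ℕ :=
  (MonoidAlgebra.lift ℕ ℕ Fˣ 1).toRingHom

theorem formalSize_single (u : Fˣ) (m : ℕ) :
    formalSize (MonoidAlgebra.single u m) = m := by
  simp [formalSize]

theorem formalSize_formal (a : F) [Decidable (a = 0)] :
    formalSize (formal a) = if a = 0 then 0 else 1 := by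
  by_cases h : a = 0
  · simp [h, formal_zero]
  · simp [formal, h, formalSize_single]

theorem formalSize_ambientMap (f : F →*₀ G) (x : AmbientSemiring F) :
    formalSize (ambientMap f x) = formalSize x := by
  induction x using MonoidAlgebra.induction_linear with
  | zero => simp
  | add x y hx hy => simp [hx, hy]
  | single u m => rw [ambientMap_single, formalSize_single, formalSize_single]

theorem exists_eq_single_add {x : AmbientSemiring F} (hx : x ≠ 0) :
    ∃ (u : Fˣ) (y : AmbientSemiring F), x = MonoidAlgebra.single u 1 + y := by
  classical
  have h0 : x.coeff ≠ 0 := fun h => hx (MonoidAlgebra.coeff_injective h)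
  obtain ⟨u, hu⟩ := Finsupp.ne_iff.1 h0
  refine ⟨u, MonoidAlgebra.ofCoeff (x.coeff - Finsupp.single u 1), ?_⟩
  apply MonoidAlgebra.coeff_injective
  ext v
  by_cases hv : u = v
  · subst hv
    simp at hu ⊢
    omega
  · simp [hv]

theorem eq_zero_of_formalSize {x : AmbientSemiring F} (h : formalSize x = 0) : x = 0 := by
  by_contra hx
  obtain ⟨u, y, rfl⟩ := exists_eq_single_add hx
  simp [formalSize_single] at h

theorem eq_single_of_formalSize {x : AmbientSemiring F} (h : formalSize x = 1) :
    ∃ u : Fˣ, x = MonoidAlgebra.single u 1 := by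
  obtain ⟨u, y, rfl⟩ := exists_eq_single_add (x := x) (by rintro rfl; simp at h)
  have hy : formalSize y = 0 := by
    simp [formalSize_single] at h
    omega
  exact ⟨u, by simp [eq_zero_of_formalSize hy]⟩

theorem eq_pair_of_formalSize {x : AmbientSemiring F} (h : formalSize x = 2) :
    ∃ u v : Fˣ, x = MonoidAlgebra.single u 1 + MonoidAlgebra.single v 1 := by
  obtain ⟨u, y, rfl⟩ := exists_eq_single_add (x := x) (by rintro rfl; simp at h)
  have hy : formalSize y = 1 := by
    simp [formalSize_single] at h
    omega
  obtain ⟨v, rfl⟩ := eq_single_of_formalSize hy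
  exact ⟨u, v, rfl⟩

end FormalSums

/-! ### Tracts -/

/-- A tract: a pointed abelian group together with an ideal of its ambient semiring (its null set)
such that every element has a unique additive inverse. -/
structure Tract where
  /-- the underlying set -/
  carrier : Type u
  [grp : CommGroupWithZero carrier]
  /-- the null set -/
  null : Ideal (AmbientSemiring carrier)
  existsUnique_neg : ∀ a : carrier, ∃! b : carrier, formal a + formal b ∈ null

instance : CoeSort Tract.{u} (Type u) := ⟨Tract.carrier⟩

instance (F : Tract.{u}) : CommGroupWithZero F := F.grp

/-- A tract morphism: a multiplicative map preserving `0`, `1` and the null sets. -/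
structure TractHom (F : Tract.{u}) (G : Tract.{v}) extends F.carrier →*₀ G.carrier where
  map_null : ∀ s ∈ F.null, ambientMap toMonoidWithZeroHom s ∈ G.null

instance (F : Tract.{u}) (G : Tract.{v}) : CoeFun (TractHom F G) (fun _ => F → G) :=
  ⟨fun f => f.toMonoidWithZeroHom⟩

namespace Tract

section Basic

variable (F : Tract.{u})

/-- The additive inverse of `a`: the unique `b` such that `a + b` is null. -/
noncomputable def neg (a : F) : F := (F.existsUnique_neg a).choose

theorem formal_add_neg_mem (a : F) : formal a + formal (F.neg a) ∈ F.null :=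
  (F.existsUnique_neg a).choose_spec.1

variable {F} in
theorem eq_neg_of_mem {a b : F} (h : formal a + formal b ∈ F.null) : b = F.neg a :=
  (F.existsUnique_neg a).choose_spec.2 b h

theorem neg_zero : F.neg 0 = 0 := by
  refine (eq_neg_of_mem ?_).symm
  simp [formal_zero]

theorem neg_neg (a : F) : F.neg (F.neg a) = a := by
  refine (eq_neg_of_mem ?_).symm
  rw [add_comm]
  exact F.formal_add_neg_mem a

variable {F} in
theorem formal_mem_null {a : F} (h : formal a ∈ F.null) : a = 0 := by
  have h' : formal (0 : F) + formal a ∈ F.null := by simpa [formal_zero] using h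
  rw [eq_neg_of_mem h', F.neg_zero]

variable {F} in
theorem neg_ne_zero {a : F} (ha : a ≠ 0) : F.neg a ≠ 0 := by
  intro h
  apply ha
  rw [← F.neg_neg a, h, F.neg_zero]

theorem formal_mul (a b : F) : formal (a * b) = formal a * formal b := by
  by_cases ha : a = 0
  · simp [ha, formal_zero]
  by_cases hb : b = 0
  · simp [hb, formal_zero]
  obtain ⟨u, rfl⟩ : ∃ u : F.carrierˣ, (u : F.carrier) = a := ⟨Units.mk0 a ha, rfl⟩
  obtain ⟨v, rfl⟩ : ∃ v : F.carrierˣ, (v : F.carrier) = b := ⟨Units.mk0 b hb, rfl⟩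
  rw [← Units.val_mul, formal_unit, formal_unit, formal_unit, MonoidAlgebra.single_mul_single]
  simp

theorem mul_neg (a b : F) : a * F.neg b = F.neg (a * b) := by
  apply eq_neg_of_mem
  rw [formal_mul, formal_mul, ← mul_add]
  exact F.null.mul_mem_left _ (F.formal_add_neg_mem b)

theorem neg_eq_mul (a : F) : F.neg a = F.neg 1 * a := by
  rw [mul_comm, mul_neg, mul_one]

/-- The element `-1` as a unit. -/
noncomputable def negOne : F.carrierˣ := Units.mk0 (F.neg 1) (neg_ne_zero one_ne_zero)

theorem negOne_mul (u : F.carrierˣ) : ((F.negOne * u : F.carrierˣ) : F) = F.neg u := by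
  rw [neg_eq_mul]
  rfl

theorem negOne_sq : F.negOne * F.negOne = 1 := by
  ext
  rw [negOne_mul]
  exact F.neg_neg 1

/-- Multiplication by a sign `±1`. -/
noncomputable def signMul (e : ℤˣ) (a : F) : F := if e = 1 then a else F.neg a

end Basic

/-- A formal sum is empty, or has at least three terms, or is of the form `u + e u`. -/
def NullShape {F : Type u} [CommGroupWithZero F] (e : Fˣ) (x : AmbientSemiring F) : Prop :=
  x = 0 ∨ 3 ≤ formalSize x ∨
    ∃ u : Fˣ, x = MonoidAlgebra.single u 1 + MonoidAlgebra.single (e * u) 1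

theorem NullShape.two_le {F : Type u} [CommGroupWithZero F] {e : Fˣ} {x : AmbientSemiring F}
    (h : NullShape e x) (hx : x ≠ 0) : 2 ≤ formalSize x := by
  rcases h with h | h | ⟨u, rfl⟩
  · exact absurd h hx
  · omega
  · simp [formalSize_single]

theorem NullShape.add {F : Type u} [CommGroupWithZero F] {e : Fˣ} {x y : AmbientSemiring F}
    (hx : NullShape e x) (hy : NullShape e y) : NullShape e (x + y) := by
  by_cases h0 : x = 0
  · simpa [h0] using hy
  by_cases h1 : y = 0
  · simpa [h1] using hx
  have := hx.two_le h0
  have := hy.two_le h1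
  refine Or.inr (Or.inl ?_)
  rw [map_add]
  omega

theorem NullShape.mul_left {F : Type u} [CommGroupWithZero F] {e : Fˣ} {x : AmbientSemiring F}
    (r : AmbientSemiring F) (hx : NullShape e x) : NullShape e (r * x) := by
  induction r using MonoidAlgebra.induction_linear with
  | zero => left; simp
  | add r s hr hs => rw [add_mul]; exact hr.add hs
  | single v m =>
    induction m with
    | zero => left; simp
    | succ m ih =>
      rw [MonoidAlgebra.single_add, add_mul]
      refine ih.add ?_
      rcases hx with rfl | hx | ⟨u, rfl⟩
      · left; simp
      · refine Or.inr (Or.inl ?_)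
        rw [map_mul, formalSize_single]
        omega
      · refine Or.inr (Or.inr ⟨v * u, ?_⟩)
        rw [mul_add, MonoidAlgebra.single_mul_single, MonoidAlgebra.single_mul_single,
          mul_left_comm, one_mul]

theorem nullShape_of_mem_span {F : Type u} [CommGroupWithZero F] {e : Fˣ}
    {R : Set (AmbientSemiring F)} (hR : ∀ x ∈ R, NullShape e x) {x : AmbientSemiring F}
    (hx : x ∈ Ideal.span R) : NullShape e x := by
  induction hx using Submodule.span_induction with
  | mem x h => exact hR x h
  | zero => exact Or.inl rfl
  | add x y _ _ hx hy => exact hx.add hy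
  | smul r x _ hx => exact hx.mul_left r

theorem existsUnique_neg_span {F : Type u} [CommGroupWithZero F] {e : Fˣ} (he : e * e = 1)
    {R : Set (AmbientSemiring F)} (hR : ∀ x ∈ R, NullShape e x)
    (h1 : MonoidAlgebra.single 1 1 + MonoidAlgebra.single e 1 ∈ R) (a : F) :
    ∃! b : F, formal a + formal b ∈ Ideal.span R := by
  classical
  by_cases ha : a = 0
  · refine ⟨0, by simp [ha, formal_zero], ?_⟩
    intro b hb
    rw [ha, formal_zero, zero_add] at hb
    by_contra hb0
    have h := (nullShape_of_mem_span hR hb).two_le (by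
      intro h
      have := formalSize_formal b
      simp [h, hb0] at this)
    simp [formalSize_formal, hb0] at h
  · obtain ⟨u, rfl⟩ : ∃ u : Fˣ, (u : F) = a := ⟨Units.mk0 a ha, rfl⟩
    refine ⟨((e * u : Fˣ) : F), ?_, ?_⟩
    · have := (Ideal.span R).mul_mem_left (MonoidAlgebra.single u 1) (Ideal.subset_span h1)
      rw [mul_add, MonoidAlgebra.single_mul_single, MonoidAlgebra.single_mul_single] at this
      change formal (u : F) + formal ((e * u : Fˣ) : F) ∈ Ideal.span R
      rw [formal_unit, formal_unit]
      simpa [mul_comm u e] using this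
    · intro b hb
      have hs := nullShape_of_mem_span hR hb
      have hb0 : b ≠ 0 := by
        rintro rfl
        have h := hs.two_le (by
          intro h
          have := congrArg formalSize h
          simp [formalSize_formal] at this)
        simp [formalSize_formal] at h
      obtain ⟨v, rfl⟩ : ∃ v : Fˣ, (v : F) = b := ⟨Units.mk0 b hb0, rfl⟩
      rw [formal_unit, formal_unit] at hs
      congr 1
      rcases hs with h | h | ⟨w, h⟩
      · have := congrArg formalSize h
        simp [formalSize_single] at this
      · simp [formalSize_single] at h
      · have h' := congrArg MonoidAlgebra.coeff h
        simp only [MonoidAlgebra.coeff_add, MonoidAlgebra.coeff_single] at h'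
        rw [Finsupp.single_add_single_eq_single_add_single one_ne_zero one_ne_zero] at h'
        rcases h' with ⟨rfl, rfl⟩ | ⟨_, rfl, rfl⟩ | ⟨h, _⟩ | ⟨h, _⟩
        · rfl
        · rw [← mul_assoc, he, one_mul]

theorem nullShape_null (F : Tract.{u}) {x : AmbientSemiring F} (hx : x ∈ F.null) :
    NullShape F.negOne x := by
  by_cases h3 : 3 ≤ formalSize x
  · exact Or.inr (Or.inl h3)
  have h : formalSize x = 0 ∨ formalSize x = 1 ∨ formalSize x = 2 := by omega
  rcases h with h | h | h
  · exact Or.inl (eq_zero_of_formalSize h)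
  · obtain ⟨u, rfl⟩ := eq_single_of_formalSize h
    rw [← formal_unit] at hx
    exact absurd (formal_mem_null hx) u.ne_zero
  · obtain ⟨u, v, rfl⟩ := eq_pair_of_formalSize h
    refine Or.inr (Or.inr ⟨u, ?_⟩)
    rw [← formal_unit, ← formal_unit] at hx
    have := eq_neg_of_mem hx
    rw [← negOne_mul] at this
    rw [Units.ext this]

theorem NullShape.map {F : Type u} {G : Type v} [CommGroupWithZero F] [CommGroupWithZero G]
    {e : Fˣ} {x : AmbientSemiring F} (h : NullShape e x) (f : F →*₀ G) :
    NullShape (Units.map (f : F →* G) e) (ambientMap f x) := by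
  rcases h with rfl | h | ⟨u, rfl⟩
  · left; simp
  · right; left; rwa [formalSize_ambientMap]
  · right; right
    exact ⟨Units.map (f : F →* G) u, by
      rw [map_add, ambientMap_single, ambientMap_single, map_mul]⟩

/-! ### The regular partial field, free algebras and quotients -/

/-- The regular partial field `𝔽₁^± = {0, 1, -1}`, with null set `{n.1 + n.(-1) | n ∈ ℕ}`. -/
noncomputable def regularPartialField : Tract.{0} where
  carrier := SignType
  null := Ideal.span {formal (1 : SignType) + formal (-1 : SignType)}
  existsUnique_neg := by
    have e1 : formal (1 : SignType) = MonoidAlgebra.single 1 1 := formal_unit (1 : SignTypeˣ)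
    have e2 : formal (-1 : SignType) = MonoidAlgebra.single (-1) 1 := formal_unit (-1 : SignTypeˣ)
    refine existsUnique_neg_span (e := -1) (by simp) ?_ ?_
    · rintro x rfl
      exact Or.inr (Or.inr ⟨1, by rw [e1, e2]; simp⟩)
    · rw [e1, e2]; exact rfl

/-- The underlying pointed group of `k(xᵢ | i ∈ I)`: the monomials `a ∏ xᵢ ^ εᵢ` with `a ∈ kˣ` and
`(εᵢ) ∈ ⨁ ℤ`, together with `0`. -/
abbrev FreeCarrier (k : Tract.{u}) (I : Type v) : Type (max u v) :=
  WithZero (k.carrierˣ × Multiplicative (I →₀ ℤ))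

open Classical in
/-- The embedding `a ↦ a ∏ xᵢ ^ 0` of the constants into `k(xᵢ)`. -/
noncomputable def freeConst (k : Tract.{u}) (I : Type v) : k.carrier →*₀ FreeCarrier k I where
  toFun a := if h : a = 0 then 0 else
    (((Units.mk0 a h, 1) : k.carrierˣ × Multiplicative (I →₀ ℤ)) : FreeCarrier k I)
  map_zero' := by simp
  map_one' := by
    rw [dif_neg one_ne_zero, Units.mk0_one]
    rfl
  map_mul' a b := by
    by_cases ha : a = 0
    · simp [ha]
    by_cases hb : b = 0
    · simp [hb]
    rw [dif_neg ha, dif_neg hb, dif_neg (mul_ne_zero ha hb), ← WithZero.coe_mul,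
      Prod.mk_mul_mk, mul_one, Units.mk0_mul]

/-- The free algebra `k(xᵢ | i ∈ I)`; its null set is generated by the null set of `k`. -/
noncomputable def free (k : Tract.{u}) (I : Type v) : Tract.{max u v} where
  carrier := FreeCarrier k I
  null := Ideal.span (ambientMap (freeConst k I) '' (k.null : Set (AmbientSemiring k)))
  existsUnique_neg := by
    refine existsUnique_neg_span (e := Units.map (freeConst k I).toMonoidHom k.negOne)
      ?_ ?_ ?_
    · rw [← map_mul, negOne_sq, map_one]
    · rintro _ ⟨x, hx, rfl⟩
      exact (nullShape_null k hx).map _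
    · refine ⟨formal 1 + formal (k.neg 1), k.formal_add_neg_mem 1, ?_⟩
      rw [map_add, ambientMap_formal, ambientMap_formal, map_one]
      congr 1
      · exact formal_unit 1
      · exact formal_unit (Units.map (freeConst k I).toMonoidHom k.negOne)

/-- The generator `xᵢ` of the free algebra `k(xᵢ | i ∈ I)`. -/
noncomputable def gen (k : Tract.{u}) (I : Type v) (i : I) : free k I :=
  WithZero.coe ((1, Multiplicative.ofAdd (Finsupp.single i 1)) :
    k.carrierˣ × Multiplicative (I →₀ ℤ))

section Quotient

variable (F : Tract.{u}) (S : Set (AmbientSemiring F))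

/-- The congruence generated by the relations `a ∼ b` for which the formal sum `a - b` is
in `S`. -/
def quotientCon : Con F.carrier := conGen fun a b => formal a + formal (F.neg b) ∈ S

variable {F S}

theorem quotientCon_zero (hS : ∀ u : F.carrierˣ, MonoidAlgebra.single u 1 ∉ S) {a b : F}
    (h : F.quotientCon S a b) : a = 0 ↔ b = 0 := by
  let c : Con F.carrier :=
    { r := fun a b => a = 0 ↔ b = 0
      iseqv := ⟨fun _ => Iff.rfl, fun h => h.symm, fun h h' => h.trans h'⟩
      mul' := by
        intro w x y z h h'
        simp only [mul_eq_zero]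
        rw [h, h'] }
  have hc : F.quotientCon S ≤ c := by
    apply Con.conGen_le.2
    intro a b hab
    change a = 0 ↔ b = 0
    constructor
    · rintro rfl
      by_contra hb
      rw [formal_zero, zero_add] at hab
      have := formal_unit (Units.mk0 _ (neg_ne_zero hb))
      rw [Units.val_mk0] at this
      exact hS _ (this ▸ hab)
    · rintro rfl
      by_contra ha
      rw [F.neg_zero, formal_zero, add_zero] at hab
      have := formal_unit (Units.mk0 _ ha)
      rw [Units.val_mk0] at this
      exact hS _ (this ▸ hab)
  exact hc h

theorem quotientCon_inv (hS : ∀ u : F.carrierˣ, MonoidAlgebra.single u 1 ∉ S) {a b : F}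
    (h : F.quotientCon S a b) : F.quotientCon S a⁻¹ b⁻¹ := by
  by_cases ha : a = 0
  · rw [ha, (quotientCon_zero hS h).1 ha]
    exact (F.quotientCon S).refl _
  have hb : b ≠ 0 := fun hb => ha ((quotientCon_zero hS h).2 hb)
  have h2 := (F.quotientCon S).mul ((F.quotientCon S).refl (a⁻¹ * b⁻¹)) ((F.quotientCon S).symm h)
  have e1 : a⁻¹ * b⁻¹ * b = a⁻¹ := by rw [mul_assoc, inv_mul_cancel₀ hb, mul_one]
  have e2 : a⁻¹ * b⁻¹ * a = b⁻¹ := by rw [mul_right_comm, inv_mul_cancel₀ ha, one_mul]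
  rwa [e1, e2] at h2

/-- The quotient monoid is a pointed group. -/
noncomputable abbrev quotientGroup (hS : ∀ u : F.carrierˣ, MonoidAlgebra.single u 1 ∉ S) :
    CommGroupWithZero (F.quotientCon S).Quotient :=
  { (inferInstance : CommMonoid (F.quotientCon S).Quotient) with
    zero := ((0 : F.carrier) : (F.quotientCon S).Quotient)
    zero_mul := by
      intro a
      induction a using Con.induction_on with
      | H a =>
        change (((0 * a : F.carrier)) : (F.quotientCon S).Quotient) = _
        rw [zero_mul]
        rfl
    mul_zero := by
      intro a
      induction a using Con.induction_on with
      | H a =>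
        change (((a * 0 : F.carrier)) : (F.quotientCon S).Quotient) = _
        rw [mul_zero]
        rfl
    inv := fun a => Con.liftOn a (fun a => ((a⁻¹ : F.carrier) : (F.quotientCon S).Quotient))
      (fun _ _ h => (Con.eq _).2 (quotientCon_inv hS h))
    exists_pair_ne := ⟨((0 : F.carrier) : (F.quotientCon S).Quotient),
      ((1 : F.carrier) : (F.quotientCon S).Quotient), fun h =>
        one_ne_zero ((quotientCon_zero hS ((Con.eq _).1 h)).1 rfl)⟩
    inv_zero := by
      change (((0 : F.carrier)⁻¹ : F.carrier) : (F.quotientCon S).Quotient) = _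
      rw [inv_zero]
      rfl
    mul_inv_cancel := by
      intro a
      induction a using Con.induction_on with
      | H a =>
        intro ha
        have ha' : a ≠ 0 := by
          rintro rfl
          exact ha rfl
        change ((a * a⁻¹ : F.carrier) : (F.quotientCon S).Quotient) = _
        rw [mul_inv_cancel₀ ha']
        rfl }

/-- The projection onto the quotient, as a morphism of pointed groups. -/
noncomputable def quotientMk (hS : ∀ u : F.carrierˣ, MonoidAlgebra.single u 1 ∉ S) :
    letI := quotientGroup hS
    F.carrier →*₀ (F.quotientCon S).Quotient :=
  letI := quotientGroup hS
  { toFun := fun a => (a : (F.quotientCon S).Quotient)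
    map_zero' := rfl
    map_one' := rfl
    map_mul' := fun _ _ => rfl }

variable (F S) in
/-- The quotient of a tract `F` by a set `S` of formal sums without elements of `Fˣ`: the quotient
monoid `F / ∼`, whose null set is the ideal generated by the images of the null set of `F` and of
`S`. -/
noncomputable def quotient (hS : ∀ u : F.carrierˣ, MonoidAlgebra.single u 1 ∉ S) : Tract.{u} :=
  letI := quotientGroup hS
  { carrier := (F.quotientCon S).Quotient
    grp := quotientGroup hS
    null := Ideal.span (ambientMap (quotientMk hS) '' ((F.null : Set (AmbientSemiring F)) ∪ S))
    existsUnique_neg := by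
      refine existsUnique_neg_span
        (e := Units.map (quotientMk hS).toMonoidHom F.negOne) ?_ ?_ ?_
      · rw [← map_mul, negOne_sq, map_one]
      · rintro _ ⟨x, hx | hx, rfl⟩
        · exact (nullShape_null F hx).map _
        · by_cases h3 : 3 ≤ formalSize x
          · exact Or.inr (Or.inl (by rwa [formalSize_ambientMap]))
          have h : formalSize x = 0 ∨ formalSize x = 1 ∨ formalSize x = 2 := by omega
          rcases h with h | h | h
          · exact Or.inl (by rw [eq_zero_of_formalSize h, map_zero])
          · obtain ⟨u, rfl⟩ := eq_single_of_formalSize h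
            exact absurd hx (hS u)
          · obtain ⟨u, w, rfl⟩ := eq_pair_of_formalSize h
            refine Or.inr (Or.inr ⟨Units.map (quotientMk hS).toMonoidHom u, ?_⟩)
            rw [map_add, ambientMap_single, ambientMap_single, ← map_mul]
            congr 2
            ext
            change ((w : F.carrier) : (F.quotientCon S).Quotient) =
              (((F.negOne * u : F.carrierˣ) : F.carrier) : (F.quotientCon S).Quotient)
            refine (Con.eq _).2 (ConGen.Rel.of _ _ ?_)
            rw [negOne_mul, neg_neg, add_comm, formal_unit, formal_unit]
            exact hx
      · refine ⟨formal 1 + formal (F.neg 1), Or.inl (F.formal_add_neg_mem 1), ?_⟩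
        rw [map_add, ambientMap_formal, ambientMap_formal, map_one]
        congr 1
        · exact formal_unit 1
        · exact formal_unit (Units.map (quotientMk hS).toMonoidHom F.negOne) }

/-- The projection onto the quotient, as a tract morphism. -/
noncomputable def quotientProj (hS : ∀ u : F.carrierˣ, MonoidAlgebra.single u 1 ∉ S) :
    TractHom F (F.quotient S hS) where
  toMonoidWithZeroHom := quotientMk hS
  map_null := fun s hs => Ideal.subset_span ⟨s, Or.inl hs, rfl⟩

theorem quotientCon_le_of_map {G : Tract.{v}} (f : TractHom F G)
    (hf : ∀ s ∈ S, ambientMap f.toMonoidWithZeroHom s ∈ G.null) {a b : F}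
    (h : F.quotientCon S a b) : f a = f b := by
  have hc : F.quotientCon S ≤ Con.ker f.toMonoidWithZeroHom := by
    apply Con.conGen_le.2
    intro a b hab
    change f a = f b
    have h1 := hf _ hab
    have h2 := f.map_null _ (F.formal_add_neg_mem b)
    rw [map_add, ambientMap_formal, ambientMap_formal, add_comm] at h1 h2
    rw [eq_neg_of_mem h1, eq_neg_of_mem h2]
  exact hc h

/-- The map `[a] ↦ f a`, as a morphism of pointed groups. -/
noncomputable def quotientLiftHom (hS : ∀ u : F.carrierˣ, MonoidAlgebra.single u 1 ∉ S)
    {G : Tract.{v}} (f : TractHom F G)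
    (hf : ∀ s ∈ S, ambientMap f.toMonoidWithZeroHom s ∈ G.null) :
    letI := quotientGroup hS
    (F.quotientCon S).Quotient →*₀ G.carrier :=
  letI := quotientGroup hS
  { toFun := fun a => Con.liftOn a (fun a => f a) (fun _ _ h => quotientCon_le_of_map f hf h)
    map_zero' := map_zero f.toMonoidWithZeroHom
    map_one' := map_one f.toMonoidWithZeroHom
    map_mul' := by
      intro a b
      induction a using Con.induction_on with
      | H a =>
        induction b using Con.induction_on with
        | H b => exact map_mul f.toMonoidWithZeroHom a b }

/-- The morphism `F // S → G`, `[a] ↦ f a`, induced by a tract morphism `f : F → G` that maps all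
formal sums in `S` to null sums. -/
noncomputable def quotientLift (hS : ∀ u : F.carrierˣ, MonoidAlgebra.single u 1 ∉ S)
    {G : Tract.{v}} (f : TractHom F G)
    (hf : ∀ s ∈ S, ambientMap f.toMonoidWithZeroHom s ∈ G.null) :
    TractHom (F.quotient S hS) G where
  toMonoidWithZeroHom := quotientLiftHom hS f hf
  map_null := by
    let _ := quotientGroup hS
    have : Ideal.span (ambientMap (quotientMk hS) '' ((F.null : Set (AmbientSemiring F)) ∪ S)) ≤
        Ideal.comap (ambientMap (quotientLiftHom hS f hf)) G.null := by
      refine Ideal.span_le.2 ?_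
      rintro _ ⟨x, hx, rfl⟩
      change ambientMap _ _ ∈ G.null
      rw [ambientMap_comp]
      rcases hx with hx | hx
      · exact f.map_null x hx
      · exact hf x hx
    exact fun s hs => this hs

/-- A multiplicative map on `F` with `0 ↦ 0` that is compatible with the relations `a = b` for
`a - b` in `S` descends to the quotient. -/
noncomputable def quotientDescend (hS : ∀ u : F.carrierˣ, MonoidAlgebra.single u 1 ∉ S)
    {M : Type v} [CommGroupWithZero M] (d : F.carrier →*₀ M)
    (hd : ∀ a b : F, formal a + formal (F.neg b) ∈ S → d a = d b) :
    (F.quotient S hS).carrier →*₀ M :=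
  { toFun := fun a => Con.liftOn a (fun a => d a) (fun _ _ h =>
      (Con.conGen_le.2 hd : F.quotientCon S ≤ Con.ker d) h)
    map_zero' := map_zero d
    map_one' := map_one d
    map_mul' := by
      intro a b
      induction a using Con.induction_on with
      | H a =>
        induction b using Con.induction_on with
        | H b => exact map_mul d a b }

end Quotient

/-! ### Subtracts -/

/-- A subtract of `F`: a pointed submonoid `A` containing `-1`, with `Aˣ = A - {0}`. -/
structure Subtract (F : Tract.{u}) extends Submonoid F.carrier where
  zero_mem' : (0 : F.carrier) ∈ carrier
  negOne_mem' : F.neg 1 ∈ carrier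
  inv_mem' : ∀ a ∈ carrier, a⁻¹ ∈ carrier

noncomputable instance {F : Tract.{u}} (A : Subtract F) : CommGroupWithZero A.toSubmonoid :=
  { (inferInstance : CommMonoid A.toSubmonoid) with
    zero := ⟨0, A.zero_mem'⟩
    zero_mul := fun a => Subtype.ext (zero_mul (a : F.carrier))
    mul_zero := fun a => Subtype.ext (mul_zero (a : F.carrier))
    inv := fun a => ⟨(a : F.carrier)⁻¹, A.inv_mem' a a.2⟩
    exists_pair_ne := ⟨⟨0, A.zero_mem'⟩, 1, fun h => zero_ne_one (congrArg Subtype.val h)⟩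
    inv_zero := Subtype.ext inv_zero
    mul_inv_cancel := fun a ha => Subtype.ext
      (mul_inv_cancel₀ (a := (a : F.carrier)) (fun h => ha (Subtype.ext h))) }

/-- The inclusion of a subtract, as a morphism of pointed groups. -/
noncomputable def Subtract.incl {F : Tract.{u}} (A : Subtract F) : A.toSubmonoid →*₀ F.carrier :=
  { toFun := Subtype.val
    map_zero' := rfl
    map_one' := rfl
    map_mul' := fun _ _ => rfl }

/-- A subtract as a tract: its null set consists of the formal sums of elements of `A` that are
null in `F`. -/
noncomputable def Subtract.toTract {F : Tract.{u}} (A : Subtract F) : Tract.{u} where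
  carrier := A.toSubmonoid
  null := Ideal.comap (ambientMap A.incl) F.null
  existsUnique_neg := by
    intro a
    refine ⟨⟨F.neg a, ?_⟩, ?_, ?_⟩
    · rw [neg_eq_mul]
      exact A.mul_mem A.negOne_mem' a.2
    · change ambientMap A.incl _ ∈ F.null
      rw [map_add, ambientMap_formal, ambientMap_formal]
      exact F.formal_add_neg_mem a
    · intro b hb
      change ambientMap A.incl _ ∈ F.null at hb
      rw [map_add, ambientMap_formal, ambientMap_formal] at hb
      exact Subtype.ext (eq_neg_of_mem hb)

/-- The restriction of a tract morphism to subtracts, as a morphism of pointed groups. -/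
noncomputable def _root_.TractHom.restrictHom {F : Tract.{u}} {G : Tract.{v}} (f : TractHom F G)
    (A : Subtract F) (B : Subtract G) (h : ∀ a ∈ A.toSubmonoid, f a ∈ B.toSubmonoid) :
    A.toSubmonoid →*₀ B.toSubmonoid where
  toFun a := ⟨f a, h a a.2⟩
  map_zero' := Subtype.ext (map_zero f.toMonoidWithZeroHom)
  map_one' := Subtype.ext (map_one f.toMonoidWithZeroHom)
  map_mul' a b := Subtype.ext (map_mul f.toMonoidWithZeroHom (a : F.carrier) (b : F.carrier))

/-- The restriction of a tract morphism to subtracts. -/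
noncomputable def _root_.TractHom.restrict {F : Tract.{u}} {G : Tract.{v}} (f : TractHom F G)
    (A : Subtract F) (B : Subtract G) (h : ∀ a ∈ A.toSubmonoid, f a ∈ B.toSubmonoid) :
    TractHom A.toTract B.toTract where
  toMonoidWithZeroHom := f.restrictHom A B h
  map_null := by
    have key : ∀ s : AmbientSemiring A.toSubmonoid, ambientMap A.incl s ∈ F.null →
        ambientMap B.incl (ambientMap (f.restrictHom A B h) s) ∈ G.null := by
      intro s hs
      have := f.map_null _ hs
      rw [ambientMap_comp] at this ⊢
      exact this
    exact key

/-- The subtract of elements of degree `0`, for a grading given by a multiplicative map to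
`ℤ ∪ {0}`; here `WithZero.log` sends the exponential of `m` to `m` and `0` to `0`. -/
noncomputable def degreeZero {F : Tract.{u}} (d : F.carrier →*₀ WithZero (Multiplicative ℤ)) :
    Subtract F where
  carrier := {a | WithZero.log (d a) = 0}
  zero_mem' := by simp
  one_mem' := by simp
  mul_mem' := by
    intro a b ha hb
    by_cases h1 : d a = 0
    · simp [h1]
    by_cases h2 : d b = 0
    · simp [h2]
    simp only [Set.mem_ofPred_eq] at ha hb ⊢
    rw [map_mul, WithZero.log_mul h1 h2, ha, hb, add_zero]
  negOne_mem' := by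
    have h : F.neg 1 * F.neg 1 = 1 := by rw [mul_neg, mul_one, neg_neg]
    have h0 : d (F.neg 1) ≠ 0 := (map_ne_zero d).2 (neg_ne_zero one_ne_zero)
    have h2 := congrArg (fun a => WithZero.log (d a)) h
    simp only [map_mul, map_one, WithZero.log_one] at h2
    rw [WithZero.log_mul h0 h0] at h2
    change WithZero.log (d (F.neg 1)) = 0
    omega
  inv_mem' := by
    intro a ha
    simp only [Set.mem_ofPred_eq] at ha ⊢
    rw [map_inv₀, WithZero.log_inv, ha, _root_.neg_zero]

/-- The grading of the free algebra by total degree in the generators. -/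
noncomputable def freeDegree (k : Tract.{u}) (I : Type v) :
    (free k I).carrier →*₀ WithZero (Multiplicative ℤ) :=
  WithZero.map' ((AddMonoidHom.toMultiplicative (Finsupp.degree (σ := I) (R := ℤ))).comp
    (MonoidHom.snd k.carrierˣ (Multiplicative (I →₀ ℤ))))

theorem freeDegree_gen (k : Tract.{u}) (I : Type v) (i : I) :
    freeDegree k I (gen k I i) = WithZero.exp 1 := by
  change WithZero.map' _ (WithZero.coe _) = _
  rw [WithZero.map'_coe]
  simp [WithZero.exp]

end Tract

/-! ### Polymatroids -/

/-- A (discrete) polymatroid of rank `r` on `[n]`, given by its set of bases: an M-convex subset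
of `Δ^r_n`. -/
structure Polymatroid (n r : ℕ) where
  bases : Set (Fin n → ℕ)
  nonempty : bases.Nonempty
  sum_eq : ∀ α ∈ bases, ∑ i, α i = r
  exchange : ∀ α ∈ bases, ∀ β ∈ bases, ∀ i, α i < β i → ∃ j, β j < α j ∧
    α + Pi.single i 1 - Pi.single j 1 ∈ bases ∧ β - Pi.single i 1 + Pi.single j 1 ∈ bases

namespace Polymatroid

variable {n r : ℕ}

/-- The sum `ε_{β₁} + ⋯ + ε_{βₘ}` of standard basis vectors. -/
def sumEps (β : List (Fin n)) : Fin n → ℕ := (β.map fun i => Pi.single i 1).sum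

theorem sumEps_append (α β : List (Fin n)) : sumEps (α ++ β) = sumEps α + sumEps β := by
  simp [sumEps]

theorem sumEps_cons (i : Fin n) (β : List (Fin n)) :
    sumEps (i :: β) = Pi.single i 1 + sumEps β := by
  simp [sumEps]

theorem sumEps_ofFn {m : ℕ} (b : Fin m → Fin n) :
    sumEps (List.ofFn b) = ∑ l, Pi.single (b l) 1 := by
  simp [sumEps, List.map_ofFn, List.sum_ofFn]

theorem sum_sumEps (β : List (Fin n)) : ∑ i, sumEps β i = β.length := by
  induction β with
  | nil => simp [sumEps]
  | cons i β ih =>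
    rw [sumEps_cons]
    simp only [Pi.add_apply, Finset.sum_add_distrib, ih, List.length_cons]
    rw [Finset.sum_pi_single']
    simp
    omega

variable (J : Polymatroid n r)

/-- The infimum `δ⁻` of `J`. -/
noncomputable def lower : Fin n → ℕ := fun i => sInf ((fun α => α i) '' J.bases)

/-- The supremum `δ⁺` of `J`. -/
noncomputable def upper : Fin n → ℕ := fun i => sSup ((fun α => α i) '' J.bases)

/-- The width `δ⁺ - δ⁻`. -/
noncomputable def width : Fin n → ℕ := J.upper - J.lower

/-- The effective rank `r - |δ⁻|`. -/
noncomputable def effRank : ℕ := r - ∑ i, J.lower i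

/-- The reduction `J - δ⁻`. -/
def reduction : Set (Fin n → ℕ) := {α | α + J.lower ∈ J.bases}

/-- The tuples `β` with entries in `[n]` and `Σβ ∈ J - δ⁻`. Such a tuple necessarily has
length `J.effRank`, see `Polymatroid.Index.length_eq`. -/
abbrev Index : Type := {β : List (Fin n) // sumEps β ∈ J.reduction}

variable {J} in
theorem Index.length_eq (β : J.Index) : β.1.length = J.effRank := by
  have h := J.sum_eq _ β.2
  simp only [Pi.add_apply, Finset.sum_add_distrib, sum_sumEps] at h
  unfold effRank
  omega

/-- The free algebra `𝔽₁^±(x_β)` on symbols `x_β` for the tuples `β` with `Σβ ∈ J - δ⁻`. -/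
noncomputable abbrev freeTract : Tract.{0} := Tract.free Tract.regularPartialField J.Index

open Classical in
/-- The element `x_β`, with the convention that `x_β = 0` if `Σβ ∉ J - δ⁻`. -/
noncomputable def x (β : List (Fin n)) : J.freeTract :=
  if h : sumEps β ∈ J.reduction then Tract.gen Tract.regularPartialField J.Index ⟨β, h⟩ else 0

/-- The relations `x_{β∘σ} - sign(σ) x_β`. -/
def alternating : Set (AmbientSemiring J.freeTract) :=
  {p | ∃ (b : Fin J.effRank → Fin n) (σ : Equiv.Perm (Fin J.effRank)),
    p = formal (J.x (List.ofFn (b ∘ σ))) +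
      formal (J.freeTract.neg (J.freeTract.signMul (Equiv.Perm.sign σ) (J.x (List.ofFn b))))}

/-- The Plücker relations
`∑ₖ (-1)ᵏ x_{α i₀ ⋯ îₖ ⋯ iₛ} x_{α iₖ j₂ ⋯ jₛ}` with `2 ≤ s`, `α ∈ [n]^(r̄ - s)` and
`Σ α i₀ ⋯ iₛ j₂ ⋯ jₛ ≤ δ⁺ - δ⁻`. -/
def plucker : Set (AmbientSemiring J.freeTract) :=
  {p | ∃ (s : ℕ) (α : List (Fin n)) (i : Fin (s + 1) → Fin n) (j : List (Fin n)),
    2 ≤ s ∧ α.length + s = J.effRank ∧ j.length + 1 = s ∧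
    sumEps (α ++ List.ofFn i ++ j) ≤ J.width ∧
    p = ∑ k : Fin (s + 1), formal (J.freeTract.signMul ((-1) ^ (k : ℕ))
      (J.x (α ++ List.ofFn (k.removeNth i)) * J.x (α ++ i k :: j)))}

/-- The 3-term Plücker relations `x_{αij} x_{αkl} - x_{αik} x_{αjl} + x_{αil} x_{αjk}` with
`α ∈ [n]^(r̄ - 2)` and `Σ α i j k l ≤ δ⁺ - δ⁻`. -/
def plucker3 : Set (AmbientSemiring J.freeTract) :=
  {p | ∃ (α : List (Fin n)) (i j k l : Fin n),
    α.length + 2 = J.effRank ∧ sumEps (α ++ [i, j, k, l]) ≤ J.width ∧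
    p = formal (J.x (α ++ [i, j]) * J.x (α ++ [k, l])) +
      formal (J.freeTract.neg (J.x (α ++ [i, k]) * J.x (α ++ [j, l]))) +
      formal (J.x (α ++ [i, l]) * J.x (α ++ [j, k]))}

theorem plucker3_subset : J.plucker3 ⊆ J.plucker := by
  rintro _ ⟨α, i, j, k, l, hα, hw, rfl⟩
  refine ⟨2, α, ![i, j, k], [l], le_rfl, hα, rfl, by simpa using hw, ?_⟩
  have e0 : List.ofFn ((0 : Fin 3).removeNth ![i, j, k]) = [j, k] := rfl
  have e1 : List.ofFn ((1 : Fin 3).removeNth ![i, j, k]) = [i, k] := rfl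
  have e2 : List.ofFn ((2 : Fin 3).removeNth ![i, j, k]) = [i, j] := rfl
  rw [Fin.sum_univ_three, e0, e1, e2]
  simp [Tract.signMul]
  rw [mul_comm (J.x (α ++ [j, k]))]
  abel

/-! Facts showing that the relations have no single-term elements and are homogeneous. -/

theorem x_eq_zero_iff (β : List (Fin n)) : J.x β = 0 ↔ sumEps β ∉ J.reduction := by
  by_cases h : sumEps β ∈ J.reduction
  · rw [x, dif_pos h]
    exact ⟨fun h0 => absurd h0 WithZero.coe_ne_zero, fun h' => absurd h h'⟩
  · simp [x, h]

theorem signMul_eq_zero_iff (F : Tract.{u}) (e : ℤˣ) (a : F) : F.signMul e a = 0 ↔ a = 0 := by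
  unfold Tract.signMul
  split_ifs
  · rfl
  · exact ⟨fun h => by_contra fun h' => Tract.neg_ne_zero h' h, fun h => by rw [h, F.neg_zero]⟩

theorem neg_eq_zero_iff (F : Tract.{u}) (a : F) : F.neg a = 0 ↔ a = 0 :=
  ⟨fun h => by_contra fun h' => Tract.neg_ne_zero h' h, fun h => by rw [h, F.neg_zero]⟩

theorem sumEps_perm {m : ℕ} (b : Fin m → Fin n) (σ : Equiv.Perm (Fin m)) :
    sumEps (List.ofFn (b ∘ σ)) = sumEps (List.ofFn b) := by
  rw [sumEps_ofFn, sumEps_ofFn]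
  exact Equiv.sum_comp σ fun l => (Pi.single (b l) 1 : Fin n → ℕ)

theorem exists_second_term {s : ℕ} (α : List (Fin n)) (i : Fin (s + 1) → Fin n)
    (j : List (Fin n)) (k : Fin (s + 1))
    (hA : sumEps (α ++ List.ofFn (k.removeNth i)) ∈ J.reduction)
    (hB : sumEps (α ++ i k :: j) ∈ J.reduction) :
    ∃ k', k' ≠ k ∧ sumEps (α ++ List.ofFn (k'.removeNth i)) ∈ J.reduction ∧
      sumEps (α ++ i k' :: j) ∈ J.reduction := by
  have tot : ∀ k : Fin (s + 1), sumEps (α ++ List.ofFn (k.removeNth i)) + Pi.single (i k) 1 =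
      sumEps α + ∑ l, Pi.single (i l) 1 := by
    intro k
    rw [Fin.sum_univ_succAbove _ k, sumEps_append, sumEps_ofFn, add_assoc]
    congr 1
    rw [add_comm]
    rfl
  by_cases h : ∃ k', k' ≠ k ∧ i k' = i k
  · obtain ⟨k', hk', e⟩ := h
    refine ⟨k', hk', ?_, by rwa [e]⟩
    have := (tot k').trans (tot k).symm
    rw [e] at this
    rwa [add_right_cancel this]
  push Not at h
  set A := sumEps (α ++ List.ofFn (k.removeNth i)) with hAdef
  set B := sumEps (α ++ i k :: j) with hBdef
  have hAi : ∀ m, A m = sumEps α m + ∑ l, (Pi.single (i (k.succAbove l)) 1 : Fin n → ℕ) m := by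
    intro m
    rw [hAdef, sumEps_append, sumEps_ofFn, Pi.add_apply, Finset.sum_apply]
    rfl
  have hBi : ∀ m, B m = sumEps α m + ((Pi.single (i k) 1 : Fin n → ℕ) m + sumEps j m) := by
    intro m
    rw [hBdef, sumEps_append, sumEps_cons]
    rfl
  have hlt : A (i k) < B (i k) := by
    rw [hAi, hBi, Finset.sum_eq_zero, Pi.single_eq_same]
    · omega
    · intro l _
      exact Pi.single_eq_of_ne (h _ (Fin.succAbove_ne k l)).symm _
  obtain ⟨m, hm, h1, h2⟩ := J.exchange _ hA _ hB (i k) (by simpa using hlt)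
  replace hm : B m < A m := by simpa using hm
  obtain ⟨l, hl⟩ : ∃ l, i (k.succAbove l) = m := by
    by_contra hcon
    push Not at hcon
    rw [hAi, hBi, Finset.sum_eq_zero] at hm
    · omega
    · intro l _
      exact Pi.single_eq_of_ne (hcon l).symm _
  have hmk : m ≠ i k := by
    rintro rfl
    omega
  refine ⟨k.succAbove l, Fin.succAbove_ne k l, ?_, ?_⟩
  · have := (tot (k.succAbove l)).trans (tot k).symm
    rw [hl, ← hAdef] at this
    change _ + J.lower ∈ J.bases
    convert h1 using 1
    ext t
    have ht := congrFun this t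
    simp only [Pi.add_apply, Pi.sub_apply] at ht ⊢
    omega
  · change _ + J.lower ∈ J.bases
    convert h2 using 1
    ext t
    rw [sumEps_append, sumEps_cons, hl]
    simp only [Pi.add_apply, Pi.sub_apply]
    rw [hBi t]
    omega

/-- All defining relations of the extended universal tract. -/
def relations : Set (AmbientSemiring J.freeTract) := J.alternating ∪ J.plucker

/-- All defining relations of the extended universal pasture. -/
def relations3 : Set (AmbientSemiring J.freeTract) := J.alternating ∪ J.plucker3

theorem relations3_subset : J.relations3 ⊆ J.relations :=
  Set.union_subset_union_right _ J.plucker3_subset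

theorem single_notMem_relations (u : J.freeTract.carrierˣ) :
    MonoidAlgebra.single u 1 ∉ J.relations := by
  classical
  rintro (⟨b, σ, h⟩ | ⟨s, α, i, j, -, -, -, -, h⟩)
  · replace h := congrArg formalSize h
    rw [formalSize_single, map_add, formalSize_formal, formalSize_formal] at h
    simp only [neg_eq_zero_iff, signMul_eq_zero_iff, x_eq_zero_iff, sumEps_perm] at h
    split_ifs at h <;> omega
  · replace h := congrArg formalSize h
    rw [formalSize_single, map_sum] at h
    simp only [formalSize_formal, signMul_eq_zero_iff, mul_eq_zero, x_eq_zero_iff] at h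
    obtain ⟨k, -, hk⟩ := Finset.exists_ne_zero_of_sum_ne_zero (h ▸ one_ne_zero)
    have hk' : ¬ (sumEps (α ++ List.ofFn (k.removeNth i)) ∉ J.reduction ∨
        sumEps (α ++ i k :: j) ∉ J.reduction) := fun h' => hk (if_pos h')
    push Not at hk'
    obtain ⟨k', hne, h1, h2⟩ := J.exists_second_term α i j k hk'.1 hk'.2
    rw [← Finset.add_sum_erase _ _ (Finset.mem_univ k),
      ← Finset.add_sum_erase _ _ (Finset.mem_erase.2 ⟨hne, Finset.mem_univ k'⟩)] at h
    simp [hk'.1, hk'.2, h1, h2] at h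

/-- The total degree on the free algebra, with `x_β` of degree `1`. -/
noncomputable def freeDegree : J.freeTract.carrier →*₀ WithZero (Multiplicative ℤ) :=
  Tract.freeDegree _ _

theorem map_neg_eq {F : Tract.{u}} (d : F.carrier →*₀ WithZero (Multiplicative ℤ)) (a : F) :
    d (F.neg a) = d a := by
  have h := (Tract.degreeZero d).negOne_mem'
  have h0 : d (F.neg 1) ≠ 0 := (map_ne_zero d).2 (Tract.neg_ne_zero one_ne_zero)
  have h1 : d (F.neg 1) = 1 := by
    rw [← WithZero.exp_log h0, show WithZero.log (d (F.neg 1)) = 0 from h, WithZero.exp_zero]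
  rw [F.neg_eq_mul, map_mul, h1, one_mul]

theorem map_signMul_eq {F : Tract.{u}} (d : F.carrier →*₀ WithZero (Multiplicative ℤ)) (e : ℤˣ)
    (a : F) : d (F.signMul e a) = d a := by
  unfold Tract.signMul
  split_ifs
  · rfl
  · exact map_neg_eq d a

theorem freeDegree_x {β : List (Fin n)} (h : J.x β ≠ 0) :
    J.freeDegree (J.x β) = WithZero.exp 1 := by
  have h' : sumEps β ∈ J.reduction := by
    by_contra h'
    exact h ((J.x_eq_zero_iff β).2 h')
  rw [x, dif_pos h']
  exact Tract.freeDegree_gen _ _ _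

theorem coeff_formal_ne_zero {F : Type u} [CommGroupWithZero F] {a : F} {v : Fˣ}
    (h : (formal a).coeff v ≠ 0) : a = v := by
  classical
  by_cases ha : a = 0
  · simp [ha, formal_zero] at h
  · obtain ⟨w, rfl⟩ : ∃ w : Fˣ, (w : F) = a := ⟨Units.mk0 a ha, rfl⟩
    rw [formal_unit, MonoidAlgebra.coeff_single, Finsupp.single_apply_ne_zero] at h
    rw [h.1]

theorem homogeneous_relations {p : AmbientSemiring J.freeTract} (hp : p ∈ J.relations) :
    ∃ d : ℤ, ∀ v, p.coeff v ≠ 0 → J.freeDegree (v : J.freeTract.carrier) = WithZero.exp d := by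
  rcases hp with ⟨b, σ, rfl⟩ | ⟨s, α, i, j, -, -, -, -, rfl⟩
  · refine ⟨1, fun v hv => ?_⟩
    rw [MonoidAlgebra.coeff_add, Finsupp.add_apply] at hv
    have hv' := not_and_or.1 fun h => hv (Nat.add_eq_zero_iff.2 h)
    rcases hv' with hv | hv
    · have := coeff_formal_ne_zero hv
      rw [← this]
      exact J.freeDegree_x (this ▸ v.ne_zero)
    · have := coeff_formal_ne_zero hv
      rw [← this, map_neg_eq, map_signMul_eq]
      refine J.freeDegree_x fun h => ?_
      rw [h, (signMul_eq_zero_iff _ _ _).2 rfl, Tract.neg_zero] at this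
      exact v.ne_zero this.symm
  · refine ⟨2, fun v hv => ?_⟩
    rw [MonoidAlgebra.coeff_sum, Finsupp.finsetSum_apply] at hv
    obtain ⟨k, -, hk⟩ := Finset.exists_ne_zero_of_sum_ne_zero hv
    have := coeff_formal_ne_zero hk
    have h0 : J.x (α ++ List.ofFn (k.removeNth i)) * J.x (α ++ i k :: j) ≠ 0 := by
      intro h
      rw [h, (signMul_eq_zero_iff _ _ _).2 rfl] at this
      exact v.ne_zero this.symm
    rw [← this, map_signMul_eq, map_mul, J.freeDegree_x (left_ne_zero_of_mul h0),
      J.freeDegree_x (right_ne_zero_of_mul h0), ← WithZero.exp_add]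
    rfl

theorem freeDegree_eq_of_mem {a b : J.freeTract}
    (h : formal a + formal (J.freeTract.neg b) ∈ J.relations) :
    J.freeDegree a = J.freeDegree b := by
  by_cases ha : a = 0
  · by_cases hb : b = 0
    · rw [ha, hb]
    · rw [ha, formal_zero, zero_add] at h
      have := formal_unit (Units.mk0 _ (Tract.neg_ne_zero hb))
      rw [Units.val_mk0] at this
      exact absurd (this ▸ h) (J.single_notMem_relations _)
  · by_cases hb : b = 0
    · rw [hb, Tract.neg_zero, formal_zero, add_zero] at h
      have := formal_unit (Units.mk0 _ ha)
      rw [Units.val_mk0] at this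
      exact absurd (this ▸ h) (J.single_notMem_relations _)
    · obtain ⟨d, hd⟩ := J.homogeneous_relations h
      obtain ⟨v, rfl⟩ : ∃ v : J.freeTract.carrierˣ, (v : J.freeTract.carrier) = a :=
        ⟨Units.mk0 a ha, rfl⟩
      obtain ⟨w, hw⟩ : ∃ w : J.freeTract.carrierˣ,
          (w : J.freeTract.carrier) = J.freeTract.neg b :=
        ⟨Units.mk0 _ (Tract.neg_ne_zero hb), rfl⟩
      rw [← hw, formal_unit, formal_unit] at h hd
      rw [← map_neg_eq _ b, ← hw, hd v (by simp), hd w (by simp)]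

/-! ### The universal tract, the universal pasture and the comparison maps -/

/-- The extended universal tract of `J`. -/
noncomputable def extUniversalTract : Tract.{0} :=
  J.freeTract.quotient J.relations J.single_notMem_relations

/-- The extended universal pasture of `J`. -/
noncomputable def extUniversalPasture : Tract.{0} :=
  J.freeTract.quotient J.relations3 fun u hu =>
    J.single_notMem_relations u (J.relations3_subset hu)

/-- The grading of the extended universal tract, with `x_β` of degree `1`. -/
noncomputable def degTract : J.extUniversalTract.carrier →*₀ WithZero (Multiplicative ℤ) :=
  Tract.quotientDescend _ J.freeDegree fun _ _ h => J.freeDegree_eq_of_mem h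

/-- The grading of the extended universal pasture, with `x_β` of degree `1`. -/
noncomputable def degPasture : J.extUniversalPasture.carrier →*₀ WithZero (Multiplicative ℤ) :=
  Tract.quotientDescend _ J.freeDegree fun _ _ h =>
    J.freeDegree_eq_of_mem (J.relations3_subset h)

/-- The universal tract of `J`: the degree `0` part of the extended universal tract. -/
noncomputable def universalTract : Tract.{0} := (Tract.degreeZero J.degTract).toTract

/-- The universal pasture of `J`: the degree `0` part of the extended universal pasture. -/
noncomputable def universalPasture : Tract.{0} := (Tract.degreeZero J.degPasture).toTract

/-- The canonical morphism from the extended universal pasture to the extended universal tract,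
sending the class of `a` to the class of `a`. -/
noncomputable def extComparison : TractHom J.extUniversalPasture J.extUniversalTract :=
  Tract.quotientLift _ (Tract.quotientProj J.single_notMem_relations) fun s hs =>
    Ideal.subset_span ⟨s, Or.inr (J.relations3_subset hs), rfl⟩

theorem degTract_extComparison (a : J.extUniversalPasture) :
    J.degTract (J.extComparison a) = J.degPasture a := by
  induction a using Con.induction_on with
  | H a => rfl

/-- The canonical morphism from the universal pasture to the universal tract: the restriction
of `J.extComparison` to the elements of degree `0`. -/
noncomputable def comparison : TractHom J.universalPasture J.universalTract :=
  J.extComparison.restrict (Tract.degreeZero J.degPasture) (Tract.degreeZero J.degTract)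
    fun a ha => by
      change WithZero.log (J.degTract (J.extComparison a)) = 0
      rw [degTract_extComparison]
      exact ha

end Polymatroid

/-! Both carriers are quotient monoids of the same free tract, so surjectivity is clear, and
injectivity says that (A) and (P) generate no larger congruence than (A) and (P3). A congruence sees
only relations of the shape a + (-b); a relation with three or more nonzero terms enlarges the null
set but identifies nothing. As no relation has a single nonzero term, it remains to treat a Plücker
relation with exactly two nonzero terms, at indices k < l, and to show that these cancel modulo (A)
and (P3) (`plucker_terms_eq`).

Write a = i_k and b = i_l, let W be the content of α together with all i_m for m ≠ k, l, and V the
content of αj. By (A), the ratio f(W) = x_{wa} / x_{wb} depends only on the content W of w, and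
after a sign count the cancellation reads f(W) = f(V). A three-term relation in which one product
vanishes gives such an equality for contents α + ε_c and α + ε_d (`ratio_exchange`). The vanishing
of the other Plücker terms says that, whenever V_c < W_c, one of W - ε_c + ε_a + ε_b and V + ε_c is
not in the reduction of J.

What remains is a statement about M-convex sets, `eq_of_degenerate`, proved by induction on the sum
of the positive parts of W - V. If some W - ε_c + ε_a + ε_b is missing, one unit of W moves towards
V; otherwise every V + ε_c is missing and one unit of V moves towards W. The exchange property
supplies the move, the missing vector makes it a degenerate three-term relation, and the vanishing
condition survives the move. -/

namespace Polymatroid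

variable {n r : ℕ}

/-! ### M-convex sets and the distance between two vectors -/

/-- The standard basis vector `ε_c` of `ℕⁿ`. -/
abbrev eps (c : Fin n) : Fin n → ℕ := Pi.single c 1

/-- The exchange property of M-convex sets, without truncated subtraction. -/
def Exchange (B : Set (Fin n → ℕ)) : Prop :=
  ∀ α ∈ B, ∀ β ∈ B, ∀ i, α i < β i → ∃ j, β j < α j ∧
    (∀ γ, γ + eps j = α + eps i → γ ∈ B) ∧
    (∀ γ, γ + eps i = β + eps j → γ ∈ B)

theorem exchange_reduction (J : Polymatroid n r) : Exchange J.reduction := by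
  intro α hα β hβ i hi
  obtain ⟨j, hj, h1, h2⟩ := J.exchange _ hα _ hβ i (by simpa using hi)
  refine ⟨j, by simpa using hj, fun γ hγ => ?_, fun γ hγ => ?_⟩
  · change _ ∈ J.bases
    convert h1 using 1
    ext t
    have := congrFun hγ t
    simp only [eps, Pi.add_apply, Pi.sub_apply] at this ⊢
    omega
  · change _ ∈ J.bases
    convert h2 using 1
    ext t
    have := congrFun hγ t
    -- Since β i > α i ≥ 0, the truncated subtraction in `J.exchange` loses nothing.
    have h3 : (Pi.single i 1 : Fin n → ℕ) t ≤ β t := by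
      by_cases h : t = i
      · subst h; rw [Pi.single_eq_same]; omega
      · rw [Pi.single_eq_of_ne h]; omega
    simp only [eps, Pi.add_apply, Pi.sub_apply] at this ⊢
    omega

theorem exists_eq_add_single {W : Fin n → ℕ} {c : Fin n} (h : 0 < W c) :
    ∃ α : Fin n → ℕ, W = α + eps c := by
  refine ⟨W - eps c, (tsub_add_cancel_of_le fun t => ?_).symm⟩
  by_cases ht : t = c
  · subst ht; rw [eps, Pi.single_eq_same]; exact h
  · rw [eps, Pi.single_eq_of_ne ht]; exact Nat.zero_le _

theorem eps_self (c : Fin n) : eps c c = 1 := Pi.single_eq_same _ _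

theorem eps_of_ne {c d : Fin n} (h : c ≠ d) : eps c d = 0 :=
  Pi.single_eq_of_ne h.symm _

theorem exists_lt_of_sum_eq {W V : Fin n → ℕ} (hs : ∑ i, W i = ∑ i, V i) (hne : W ≠ V) :
    ∃ c, V c < W c := by
  by_contra! h
  exact hne (funext fun i => (Finset.sum_eq_sum_iff_of_le fun i _ => h i).1 hs i (Finset.mem_univ i))

/-- The unit at c counts towards the excess over V, while at d there is room below V for it. This is
the descent when W moves towards V. -/
theorem sum_tsub_lt_left {α V : Fin n → ℕ} {c d : Fin n}
    (hc : V c < (α + eps c) c) (hd : α d < V d) :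
    ∑ m, ((α + eps d) m - V m) < ∑ m, ((α + eps c) m - V m) := by
  have hcd : d ≠ c := by
    rintro rfl
    simp at hc
    omega
  refine Finset.sum_lt_sum (fun m _ => ?_) ⟨c, Finset.mem_univ c, ?_⟩
  · by_cases hm : d = m
    · subst hm
      have := eps_self d
      simp only [Pi.add_apply]
      omega
    · have := eps_of_ne hm
      simp only [Pi.add_apply]
      omega
  · have := eps_of_ne hcd
    have := eps_self c
    simp only [Pi.add_apply] at hc ⊢
    omega

/-- The mirror image of `sum_tsub_lt_left`: the descent when V moves towards W. -/
theorem sum_tsub_lt_right {W β : Fin n → ℕ} {c d : Fin n}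
    (hc : (β + eps d) c < W c) (hd : W d < (β + eps d) d) :
    ∑ m, (W m - (β + eps c) m) < ∑ m, (W m - (β + eps d) m) := by
  have hcd : d ≠ c := by
    rintro rfl
    omega
  refine Finset.sum_lt_sum (fun m _ => ?_) ⟨c, Finset.mem_univ c, ?_⟩
  · by_cases hm : d = m
    · subst hm
      have := eps_self d
      simp only [Pi.add_apply] at hd ⊢
      omega
    · have := eps_of_ne hm
      simp only [Pi.add_apply]
      omega
  · have := eps_of_ne hcd
    have := eps_self c
    simp only [Pi.add_apply] at hc ⊢
    omega

/-- Leaves only two candidates for the index returned by an exchange between vectors with a large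
common part; one of them is then usually excluded by a vector missing from B. -/
theorem eq_or_eq_of_lt {α : Fin n → ℕ} {c d e f j : Fin n} (h : (α + eps c + eps d) j
    < (α + eps e + eps f) j) : j = e ∨ j = f := by
  by_contra! hj
  have := eps_of_ne hj.1.symm
  have := eps_of_ne hj.2.symm
  simp only [Pi.add_apply] at h
  omega

/-! ### From elementary degenerate exchanges to arbitrary ones -/

/-- A function on `ℕⁿ` that is invariant under the elementary exchanges which come from degenerate
three-term relations is invariant under all exchanges which come from degenerate relations. -/
theorem eq_of_degenerate {X : Type*} {B : Set (Fin n → ℕ)} (hB : Exchange B) {a b : Fin n}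
    (f : (Fin n → ℕ) → X)
    (hf : ∀ α c d, c ≠ d → α + eps c + eps a ∈ B →
      α + eps c + eps b ∈ B → α + eps d + eps a ∈ B →
      α + eps d + eps b ∈ B →
      (α + eps a + eps b ∉ B ∨ α + eps c + eps d ∉ B) →
      f (α + eps c) = f (α + eps d)) (W V : Fin n → ℕ)
    (hs : ∑ i, W i = ∑ i, V i)
    (hWa : W + eps a ∈ B) (hWb : W + eps b ∈ B)
    (hVa : V + eps a ∈ B) (hVb : V + eps b ∈ B)
    (hWV : ∀ c γ, V c < W c → γ + eps c = W → γ + eps a + eps b ∈ B →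
      V + eps c ∉ B) : f W = f V := by
  induction hN : ∑ m, (W m - V m) using Nat.strong_induction_on generalizing W V with
  | _ N ih =>
  subst hN
  by_cases hne : W = V
  · rw [hne]
  -- If such a c exists, W moves; otherwise `hWV` forces V + ε_e ∉ B for every e with V e < W e, and
  -- V moves.
  by_cases hA : ∃ c γ, V c < W c ∧ γ + eps c = W ∧ γ + eps a + eps b ∉ B
  · obtain ⟨c, α, hc, rfl, hα⟩ := hA
    have hca : a ≠ c := by
      rintro rfl
      exact hα hWb
    have hcb : b ≠ c := by
      rintro rfl
      apply hα
      convert hWa using 1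
      abel
    -- The new W is α + ε_d, with d chosen by exchanging V + ε_a against W + ε_a at c.
    obtain ⟨d, hd, -, h2⟩ := hB _ hVa _ hWa c (by simpa using hc)
    have hda : α + eps d + eps a ∈ B := h2 _ (by abel)
    have hcd : d ≠ c := by
      rintro rfl
      simp at hc hd
      omega
    have hd' : α d < V d := by
      have := eps_of_ne hcd.symm
      simp only [Pi.add_apply] at hd
      omega
    have h1 := eps_self c
    have h3 := eps_of_ne hcd
    have h4 := eps_of_ne hca
    -- Exchanging at c against W + ε_b returns d or a, and a would put the missing vector α + ε_a +
    -- ε_b into B.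
    have hdb : α + eps d + eps b ∈ B := by
      obtain ⟨j, hj, -, h⟩ := hB _ hda _ hWb c (by simp only [Pi.add_apply]; omega)
      have h' : α + eps j + eps b ∈ B := h _ (by abel)
      rcases eq_or_eq_of_lt hj with rfl | rfl
      · exact h'
      · exact absurd h' hα
    rw [hf α c d hcd.symm hWa hWb hda hdb (Or.inl hα)]
    refine ih _ (sum_tsub_lt_left hc hd') _ _ ?_ hda hdb hVa hVb ?_ rfl
    · rw [← hs]
      simp only [Pi.add_apply, Finset.sum_add_distrib, Finset.sum_pi_single']
      simp
    · intro e γ he hγ hγB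
      have hed : d ≠ e := by
        rintro rfl
        have := eps_self d
        simp only [Pi.add_apply] at he
        omega
      have h5 := eps_of_ne hed
      have h6 := eps_of_ne hed.symm
      obtain ⟨γ', rfl⟩ : ∃ γ', γ = γ' + eps d := by
        apply exists_eq_add_single
        have h := congrFun hγ d
        have := eps_self d
        simp only [Pi.add_apply] at h
        omega
      obtain rfl : γ' + eps e = α := by
        apply add_right_cancel (b := eps d)
        rw [← hγ]
        abel
      -- The old condition is applied at the same e: with W = γ' + ε_c + ε_e, it suffices that γ' +
      -- ε_c + ε_a + ε_b is in B. An exchange at c gives this, since its other outcome again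
      -- produces α + ε_a + ε_b.
      refine hWV e (γ' + eps c) ?_ (by abel) ?_
      · simp only [Pi.add_apply] at he ⊢
        omega
      · obtain ⟨j, hj, h, h'⟩ := hB _ hγB _ hWb c (by simp only [Pi.add_apply]; omega)
        have hj' : j = d ∨ j = a := by
          by_contra! hj'
          have := eps_of_ne hj'.1.symm
          have := eps_of_ne hj'.2.symm
          simp only [Pi.add_apply] at hj
          omega
        rcases hj' with rfl | rfl
        · exact h _ (by abel)
        · exact absurd (h' _ (by abel)) hα
  · push Not at hA
    have hV : ∀ e, V e < W e → V + eps e ∉ B := by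
      intro e he
      obtain ⟨γ, rfl⟩ := exists_eq_add_single (W := W) (c := e) (by omega)
      exact hWV e γ he rfl (hA e γ he rfl)
    obtain ⟨c, hc⟩ := exists_lt_of_sum_eq hs hne
    -- The same exchange, now read on the side of V: with V = β + ε_d, the new V is β + ε_c.
    obtain ⟨d, hd, h1, -⟩ := hB _ hVa _ hWa c (by simpa using hc)
    have hd' : W d < V d := by simpa using hd
    obtain ⟨β, rfl⟩ := exists_eq_add_single (W := V) (c := d) (by omega)
    have hca : β + eps c + eps a ∈ B := h1 _ (by abel)
    have hdc : d ≠ c := by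
      rintro rfl
      omega
    have hbc : c ≠ b := by
      rintro rfl
      exact hV _ hc hVb
    have h2 := eps_self b
    have h3 := eps_of_ne hbc
    have hcb : β + eps c + eps b ∈ B := by
      by_cases hab : a = b
      · exact hab ▸ hca
      have h4 := eps_of_ne hab
      obtain ⟨j, hj, h, h'⟩ := hB _ hca _ hVb b (by simp only [Pi.add_apply]; omega)
      rcases eq_or_eq_of_lt hj with rfl | rfl
      · exact absurd (h' _ (by abel)) (hV _ hc)
      · exact h _ (by abel)
    -- The step is degenerate because β + ε_c + ε_d is V + ε_c, which is missing.
    rw [← hf β c d hdc.symm hca hcb hVa hVb (Or.inr fun h => hV _ hc (by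
      convert h using 1
      abel))]
    refine ih _ (sum_tsub_lt_right hc hd') _ _ ?_ hWa hWb hca hcb ?_ rfl
    · rw [hs]
      simp only [Pi.add_apply, Finset.sum_add_distrib, Finset.sum_pi_single']
      simp
    -- The stronger property of this case is what persists: if the new V plus ε_e were in B, an
    -- exchange at b against the old V + ε_b would put the old V + ε_c or V + ε_e into B.
    · intro e γ he hγ _ heB
      have hde : d ≠ e := by
        rintro rfl
        have := eps_self d
        have := eps_of_ne hdc.symm
        simp only [Pi.add_apply] at he hd'
        omega
      have he' : (β + eps d) e < W e := by
        have := eps_of_ne hde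
        simp only [Pi.add_apply] at he ⊢
        omega
      have heb : e ≠ b := by
        rintro rfl
        exact hV _ he' hVb
      have h4 := eps_of_ne heb
      obtain ⟨j, hj, -, h'⟩ := hB _ heB _ hVb b (by simp only [Pi.add_apply]; omega)
      rcases eq_or_eq_of_lt hj with rfl | rfl
      · exact hV _ hc (h' _ (by abel))
      · exact hV _ he' (h' _ (by abel))

end Polymatroid

/-! ### Reading off the terms of a formal sum -/

/-- Coefficients lie in ℕ, so terms of a formal sum cannot cancel: the coefficient at a is positive,
hence some summand equals a, and it can be removed on both sides. -/
theorem exists_eq_of_sum_formal {F : Type*} [CommGroupWithZero F] {ι : Type*} [DecidableEq ι]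
    {s : Finset ι} {t : ι → F} {a : F} (ha : a ≠ 0) {y : AmbientSemiring F}
    (h : ∑ k ∈ s, formal (t k) = formal a + y) :
    ∃ k ∈ s, t k = a ∧ ∑ k ∈ s.erase k, formal (t k) = y := by
  obtain ⟨u, rfl⟩ : ∃ u : Fˣ, (u : F) = a := ⟨Units.mk0 a ha, rfl⟩
  have h1 := congrArg (fun p => p.coeff u) h
  simp only [MonoidAlgebra.coeff_add, MonoidAlgebra.coeff_sum, Finsupp.finsetSum_apply,
    Finsupp.add_apply, formal_unit, MonoidAlgebra.coeff_single, Finsupp.single_eq_same] at h1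
  obtain ⟨k, hk, hk0⟩ := Finset.exists_ne_zero_of_sum_ne_zero (h1.trans_ne (by omega))
  have hka := Polymatroid.coeff_formal_ne_zero hk0
  refine ⟨k, hk, hka, ?_⟩
  rw [← Finset.add_sum_erase _ _ hk, hka] at h
  apply MonoidAlgebra.coeff_injective
  have h2 := congrArg MonoidAlgebra.coeff h
  rw [MonoidAlgebra.coeff_add, MonoidAlgebra.coeff_add] at h2
  exact add_left_cancel h2

theorem eq_zero_of_sum_formal {F : Type*} [CommGroupWithZero F] {ι : Type*}
    {s : Finset ι} {t : ι → F} (h : ∑ k ∈ s, formal (t k) = 0) {k : ι} (hk : k ∈ s) : t k = 0 := by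
  classical
  have h1 := congrArg formalSize h
  rw [map_sum, map_zero, Finset.sum_eq_zero_iff] at h1
  have h2 := h1 k hk
  rw [formalSize_formal] at h2
  by_contra h3
  simp [h3] at h2

namespace Polymatroid

variable {n r : ℕ}

/-! ### Tuples and their contents -/

theorem sumEps_apply (w : List (Fin n)) (m : Fin n) : sumEps w m = w.count m := by
  induction w with
  | nil => simp [sumEps]
  | cons c w ih =>
    rw [sumEps_cons, Pi.add_apply, ih, List.count_cons, Pi.single_apply, add_comm]
    simp only [beq_iff_eq, eq_comm (a := m)]

theorem perm_of_sumEps_eq {w w' : List (Fin n)} (h : sumEps w = sumEps w') : w.Perm w' :=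
  List.perm_iff_count.2 fun m => by rw [← sumEps_apply, h, sumEps_apply]

theorem sumEps_concat (w : List (Fin n)) (c : Fin n) : sumEps (w ++ [c]) = sumEps w + eps c := by
  rw [sumEps_append, sumEps_cons, show sumEps ([] : List (Fin n)) = 0 from rfl, add_zero]

theorem sumEps_surjective : Function.Surjective (sumEps (n := n)) := by
  intro W
  induction hN : ∑ i, W i generalizing W with
  | zero =>
    refine ⟨[], funext fun i => ?_⟩
    exact (Finset.sum_eq_zero_iff.1 hN i (Finset.mem_univ i)).symm
  | succ N ih =>
    obtain ⟨c, -, hc⟩ := Finset.exists_ne_zero_of_sum_ne_zero (hN.trans_ne (Nat.succ_ne_zero N))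
    obtain ⟨α, rfl⟩ := exists_eq_add_single (Nat.pos_of_ne_zero hc)
    obtain ⟨w, rfl⟩ := ih α (by
      simp only [Pi.add_apply, Finset.sum_add_distrib, Finset.sum_pi_single'] at hN
      simpa using hN)
    exact ⟨w ++ [c], sumEps_concat w c⟩

theorem le_width (J : Polymatroid n r) {β : Fin n → ℕ} (h : β ∈ J.reduction) : β ≤ J.width := by
  intro m
  have hb : BddAbove ((fun α => α m) '' J.bases) := by
    refine ⟨r, ?_⟩
    rintro _ ⟨α, hα, rfl⟩
    rw [← J.sum_eq α hα]
    exact Finset.single_le_sum (f := α) (fun _ _ => Nat.zero_le _) (Finset.mem_univ m)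
  have : (β + J.lower) m ≤ J.upper m := le_csSup hb ⟨_, h, rfl⟩
  exact Nat.le_sub_of_add_le this

variable (J : Polymatroid n r)

/-! ### Signs and permutations in the extended universal pasture -/

/-- The projection of the free algebra onto the extended universal pasture. -/
noncomputable def pastureProj : J.freeTract.carrier →*₀ J.extUniversalPasture.carrier :=
  (Tract.quotientProj fun u hu =>
    J.single_notMem_relations u (J.relations3_subset hu) :
      TractHom J.freeTract J.extUniversalPasture).toMonoidWithZeroHom

theorem pastureProj_eq_iff {a b : J.freeTract} :
    J.pastureProj a = J.pastureProj b ↔ J.freeTract.quotientCon J.relations3 a b :=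
  Con.eq _

theorem pastureProj_eq {a b : J.freeTract}
    (h : formal a + formal (J.freeTract.neg b) ∈ J.relations3) :
    J.pastureProj a = J.pastureProj b :=
  J.pastureProj_eq_iff.2 (ConGen.Rel.of _ _ h)

/-- The element `-1` of the extended universal pasture. -/
noncomputable def minusOne : J.extUniversalPasture.carrier := J.pastureProj (J.freeTract.neg 1)

theorem pastureProj_neg (a : J.freeTract) :
    J.pastureProj (J.freeTract.neg a) = J.minusOne * J.pastureProj a := by
  rw [Tract.neg_eq_mul, map_mul]
  rfl

theorem minusOne_mul_self : J.minusOne * J.minusOne = 1 := by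
  have h := J.pastureProj_neg (J.freeTract.neg 1)
  rw [Tract.neg_neg, map_one] at h
  exact h.symm

theorem minusOne_ne_zero : J.minusOne ≠ 0 := by
  intro h
  have := J.minusOne_mul_self
  simp [h] at this

theorem pastureProj_signMul (k : ℕ) (a : J.freeTract) :
    J.pastureProj (J.freeTract.signMul ((-1) ^ k) a) = J.minusOne ^ k * J.pastureProj a := by
  rcases Nat.even_or_odd' k with ⟨m, rfl | rfl⟩
  · rw [pow_mul, pow_mul, pow_two J.minusOne, minusOne_mul_self]
    simp [Tract.signMul]
  · rw [pow_succ, pow_succ, pow_mul, pow_mul, pow_two J.minusOne, minusOne_mul_self]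
    simp [Tract.signMul, pastureProj_neg]

/-- The class of `x_β` in the extended universal pasture. -/
noncomputable def y (β : List (Fin n)) : J.extUniversalPasture.carrier := J.pastureProj (J.x β)

theorem y_eq_zero_iff (β : List (Fin n)) : J.y β = 0 ↔ sumEps β ∉ J.reduction := by
  rw [y, map_eq_zero, x_eq_zero_iff]

theorem y_eq_zero_of_length {β : List (Fin n)} (h : β.length ≠ J.effRank) : J.y β = 0 :=
  (J.y_eq_zero_iff β).2 fun h' => h (Index.length_eq ⟨β, h'⟩)

/-- The length is a variable m, so that this applies to the entries of a list whose length is only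
propositionally the effective rank. -/
theorem y_ofFn_swap {m : ℕ} (hm : m = J.effRank) (b : Fin m → Fin n) {i j : Fin m} (hij : i ≠ j) :
    J.y (List.ofFn (b ∘ Equiv.swap i j)) = J.minusOne * J.y (List.ofFn b) := by
  subst hm
  rw [y, y, ← pastureProj_neg]
  refine J.pastureProj_eq (Or.inl ⟨b, Equiv.swap i j, ?_⟩)
  rw [Equiv.Perm.sign_swap hij]
  simp [Tract.signMul]

theorem y_swap (p q : List (Fin n)) (c d : Fin n) :
    J.y (p ++ d :: c :: q) = J.minusOne * J.y (p ++ c :: d :: q) := by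
  by_cases h : (p ++ c :: d :: q).length = J.effRank
  · have := J.y_ofFn_swap h (p ++ c :: d :: q).get
      (i := ⟨p.length, by simp⟩) (j := ⟨p.length + 1, by simp⟩) (by simp)
    rw [List.ofFn_get] at this
    rw [← this]
    congr 1
    refine List.ext_getElem (by simp; rfl) fun t h1 h2 => ?_
    simp only [List.getElem_ofFn, Function.comp_apply, List.get_eq_getElem]
    by_cases ht : t = p.length
    · subst ht
      simp
    by_cases ht' : t = p.length + 1
    · subst ht'
      simp
    rw [Equiv.swap_apply_of_ne_of_ne (by simpa using ht) (by simpa using ht')]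
    rcases lt_or_ge t p.length with h3 | h3
    · simp [h3]
    · obtain ⟨u, rfl⟩ : ∃ u, t = p.length + (u + 2) := ⟨t - p.length - 2, by omega⟩
      simp
  · rw [J.y_eq_zero_of_length h, J.y_eq_zero_of_length (by simpa using h), mul_zero]

theorem y_move (p q : List (Fin n)) (b : Fin n) :
    J.y (p ++ b :: q) = J.minusOne ^ q.length * J.y (p ++ q ++ [b]) := by
  induction q generalizing p with
  | nil => simp
  | cons c q ih =>
    have := ih (p ++ [c])
    simp only [List.append_assoc, List.cons_append, List.nil_append] at this
    rw [y_swap, this, List.length_cons, pow_succ']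
    simp [mul_assoc]

/-- The factor η does not depend on the surrounding p and q; hence it is the same for wa and wb and
drops out of their ratio. -/
theorem exists_y_perm {w w' : List (Fin n)} (h : w.Perm w') :
    ∃ η, η ≠ 0 ∧ ∀ p q, J.y (p ++ w' ++ q) = η * J.y (p ++ w ++ q) := by
  induction h with
  | nil => exact ⟨1, one_ne_zero, fun p q => by rw [one_mul]⟩
  | cons c _ ih =>
    obtain ⟨η, h0, h⟩ := ih
    refine ⟨η, h0, fun p q => ?_⟩
    simpa using h (p ++ [c]) q
  | swap c d w =>
    refine ⟨J.minusOne, J.minusOne_ne_zero, fun p q => ?_⟩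
    simpa using J.y_swap p (w ++ q) d c
  | trans _ _ ih ih' =>
    obtain ⟨η, h0, h⟩ := ih
    obtain ⟨η', h0', h'⟩ := ih'
    exact ⟨η' * η, mul_ne_zero h0' h0, fun p q => by rw [h', h, mul_assoc]⟩

theorem y_div_y_eq {w w' : List (Fin n)} (h : sumEps w = sumEps w') (a b : Fin n) :
    J.y (w ++ [a]) / J.y (w ++ [b]) = J.y (w' ++ [a]) / J.y (w' ++ [b]) := by
  obtain ⟨η, h0, h⟩ := J.exists_y_perm (perm_of_sumEps_eq h)
  have ha := h [] [a]
  have hb := h [] [b]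
  rw [List.nil_append, List.nil_append] at ha hb
  rw [ha, hb, mul_div_mul_left _ _ h0]

/-! ### Ratios and degenerate three-term relations -/

/-- The ratio `x_{wa} / x_{wb}`, which depends only on the content `W` of `w`. -/
noncomputable def ratio (a b : Fin n) (W : Fin n → ℕ) : J.extUniversalPasture.carrier :=
  J.y (Function.surjInv sumEps_surjective W ++ [a]) /
    J.y (Function.surjInv sumEps_surjective W ++ [b])

theorem ratio_sumEps (a b : Fin n) (w : List (Fin n)) :
    J.ratio a b (sumEps w) = J.y (w ++ [a]) / J.y (w ++ [b]) :=
  J.y_div_y_eq (Function.surjInv_eq _ _) a b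

theorem y_three_term {α : List (Fin n)} {i j k l : Fin n} (hα : α.length + 2 = J.effRank)
    (hw : sumEps (α ++ [i, j, k, l]) ≤ J.width) (h0 : J.y (α ++ [i, l]) * J.y (α ++ [j, k]) = 0) :
    J.y (α ++ [i, j]) * J.y (α ++ [k, l]) = J.y (α ++ [i, k]) * J.y (α ++ [j, l]) := by
  simp only [y, ← map_mul] at h0 ⊢
  rw [map_eq_zero] at h0
  refine J.pastureProj_eq (Or.inr ⟨α, i, j, k, l, hα, hw, ?_⟩)
  rw [h0, formal_zero, add_zero]

/-- In the three-term relation for c, a, b, d the product x_{αcd} x_{αab} vanishes by `h`; the other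
two products then agree, which after division is the equality of ratios. -/
theorem ratio_exchange {a b : Fin n} (hab : a ≠ b) (α : Fin n → ℕ) (c d : Fin n) (hcd : c ≠ d)
    (hca : α + eps c + eps a ∈ J.reduction) (hcb : α + eps c + eps b ∈ J.reduction)
    (hda : α + eps d + eps a ∈ J.reduction) (hdb : α + eps d + eps b ∈ J.reduction)
    (h : α + eps a + eps b ∉ J.reduction ∨ α + eps c + eps d ∉ J.reduction) :
    J.ratio a b (α + eps c) = J.ratio a b (α + eps d) := by
  have comm : ∀ s t, α + eps s + eps t = α + eps t + eps s := fun s t => add_right_comm _ _ _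
  -- Any coincidence between {c, d} and {a, b} would turn both vectors in `h` into ones already
  -- known to lie in the reduction.
  have hca' : c ≠ a := by
    rintro rfl
    rw [comm c d] at h
    tauto
  have hcb' : c ≠ b := by
    rintro rfl
    rw [comm c d, comm a c] at h
    tauto
  have hda' : d ≠ a := by
    rintro rfl
    tauto
  have hdb' : d ≠ b := by
    rintro rfl
    rw [comm a d] at h
    tauto
  obtain ⟨w, rfl⟩ := sumEps_surjective α
  have two : ∀ s t, sumEps (w ++ [s, t]) = sumEps w + eps s + eps t := fun s t => by
    rw [show w ++ [s, t] = (w ++ [s]) ++ [t] by simp, sumEps_concat, sumEps_concat]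
  rw [← sumEps_concat, ← sumEps_concat, ratio_sumEps, ratio_sumEps]
  simp only [List.append_assoc, List.cons_append, List.nil_append]
  have ne : ∀ s t, sumEps w + eps s + eps t ∈ J.reduction → J.y (w ++ [s, t]) ≠ 0 :=
    fun s t hst h0 => (J.y_eq_zero_iff _).1 h0 (two s t ▸ hst)
  rw [div_eq_div_iff (ne _ _ hcb) (ne _ _ hdb)]
  have key := J.y_three_term (α := w) (i := c) (j := a) (k := b) (l := d)
    (by simpa using Index.length_eq ⟨w ++ [c, a], (two c a).symm ▸ hca⟩) (fun m => ?_) ?_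
  · have h1 := J.y_swap w [] b d
    have h2 := J.y_swap w [] a d
    rw [h1, h2, mul_left_comm, key, ← mul_assoc, mul_comm (J.minusOne * _),
      mul_left_comm, mul_assoc]
  · have hm : sumEps (w ++ [c, a, b, d]) m =
        sumEps w m + eps c m + eps a m + eps b m + eps d m := by
      rw [show w ++ [c, a, b, d] = w ++ [c] ++ [a] ++ [b] ++ [d] by simp]
      simp only [sumEps_concat, Pi.add_apply]
    change _ ≤ (J.width m : ℕ)
    rw [hm]
    have h1 := J.le_width hca m
    have h2 := J.le_width hdb m
    simp only [Pi.add_apply] at h1 h2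
    -- As {c, a} and {b, d} are disjoint, each coordinate of the total content is a coordinate of α
    -- + ε_c + ε_a or of α + ε_d + ε_b, both bounded by the width.
    by_cases hmc : m = c ∨ m = a
    · have := eps_of_ne (c := b) (d := m) (by rintro rfl; tauto)
      have := eps_of_ne (c := d) (d := m) (by rintro rfl; tauto)
      omega
    · push Not at hmc
      have := eps_of_ne hmc.1.symm
      have := eps_of_ne hmc.2.symm
      omega
  · rw [mul_eq_zero, y_eq_zero_iff, y_eq_zero_iff, two, two]
    tauto

theorem y_mul_y_eq {w v : List (Fin n)} {a b : Fin n}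
    (hwa : sumEps w + eps a ∈ J.reduction) (hwb : sumEps w + eps b ∈ J.reduction)
    (hva : sumEps v + eps a ∈ J.reduction) (hvb : sumEps v + eps b ∈ J.reduction)
    (h : ∀ c γ, sumEps v c < sumEps w c → γ + eps c = sumEps w →
      γ + eps a + eps b ∈ J.reduction → sumEps v + eps c ∉ J.reduction) :
    J.y (w ++ [b]) * J.y (v ++ [a]) = J.y (w ++ [a]) * J.y (v ++ [b]) := by
  by_cases hab : a = b
  · rw [hab]
  have hl : w.length = v.length := by
    rw [← sumEps_concat] at hwa hva
    have h1 := Index.length_eq ⟨_, hwa⟩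
    have h2 := Index.length_eq ⟨_, hva⟩
    simp only [List.length_append] at h1 h2
    omega
  have key := eq_of_degenerate J.exchange_reduction (J.ratio a b)
    (fun α c d => J.ratio_exchange hab α c d) (sumEps w) (sumEps v)
    (by rw [sum_sumEps, sum_sumEps, hl]) hwa hwb hva hvb h
  rw [← sumEps_concat] at hwb hvb
  rw [ratio_sumEps, ratio_sumEps, div_eq_div_iff (fun h0 => (J.y_eq_zero_iff _).1 h0 hwb)
    (fun h0 => (J.y_eq_zero_iff _).1 h0 hvb)] at key
  rw [key, mul_comm]

/-! ### Plücker relations with two nonzero terms -/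

theorem ofFn_removeNth {X : Type*} {s : ℕ} (i : Fin (s + 1) → X) (k : Fin (s + 1)) :
    List.ofFn (k.removeNth i) = (List.ofFn i).eraseIdx k := by
  refine List.ext_getElem (by simp [List.length_eraseIdx, Nat.lt_succ_iff.1 k.2]) fun t h1 h2 => ?_
  rw [List.getElem_eraseIdx]
  simp only [List.getElem_ofFn, Fin.removeNth, Fin.succAbove, Fin.lt_def, Fin.val_castSucc]
  split_ifs <;> rfl

theorem sumEps_removeNth {s : ℕ} (i : Fin (s + 1) → Fin n) (m : Fin (s + 1)) :
    sumEps (List.ofFn (m.removeNth i)) + eps (i m) = sumEps (List.ofFn i) := by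
  rw [sumEps_ofFn, sumEps_ofFn, Fin.sum_univ_succAbove _ m, add_comm]
  rfl

theorem exists_ofFn_eq_append {X : Type*} {s : ℕ} (i : Fin s → X) {k l : Fin s} (hkl : k < l) :
    ∃ p q t : List X, List.ofFn i = p ++ i k :: (q ++ i l :: t) ∧ p.length = k ∧
      p.length + 1 + q.length = l := by
  have h : ∀ (L : List X) (u : ℕ) (hu : u < L.length),
      L = L.take u ++ L[u] :: L.drop (u + 1) := by simp
  have h1 := h (List.ofFn i) k (by simp)
  have h2 := h ((List.ofFn i).drop (k + 1)) (l - (k + 1)) (by simp; omega)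
  have h3 : k + 1 + (l - (k + 1)) = (l : ℕ) := by omega
  rw [h2] at h1
  simp only [List.getElem_drop, List.getElem_ofFn, h3] at h1
  exact ⟨_, _, _, h1, by simp [k.2.le], by simp; omega⟩

theorem eraseIdx_append_cons {X : Type*} (p t : List X) (c : X) :
    (p ++ c :: t).eraseIdx p.length = p ++ t := by
  simp [List.eraseIdx_append_of_length_le]

/-- The two nonzero terms of a degenerate Plücker relation cancel in the universal pasture. -/
theorem plucker_terms_eq {s : ℕ} (α : List (Fin n)) (i : Fin (s + 1) → Fin n) (j : List (Fin n))
    {k l : Fin (s + 1)} (hkl : k < l)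
    (hne : ∀ m, (m = k ∨ m = l) →
      J.y (α ++ List.ofFn (m.removeNth i)) * J.y (α ++ i m :: j) ≠ 0)
    (h0 : ∀ m, m ≠ k → m ≠ l →
      J.y (α ++ List.ofFn (m.removeNth i)) * J.y (α ++ i m :: j) = 0) :
    J.minusOne ^ (k : ℕ) * (J.y (α ++ List.ofFn (k.removeNth i)) * J.y (α ++ i k :: j)) =
      J.minusOne * (J.minusOne ^ (l : ℕ) *
        (J.y (α ++ List.ofFn (l.removeNth i)) * J.y (α ++ i l :: j))) := by
  have red : ∀ m, J.y (α ++ List.ofFn (m.removeNth i)) * J.y (α ++ i m :: j) ≠ 0 ↔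
      sumEps (α ++ List.ofFn (m.removeNth i)) ∈ J.reduction ∧
        sumEps (α ++ i m :: j) ∈ J.reduction := fun m => by
    rw [mul_ne_zero_iff, Ne, y_eq_zero_iff, Ne, y_eq_zero_iff, not_not, not_not]
  obtain ⟨hka, hkb⟩ := (red k).1 (hne k (Or.inl rfl))
  obtain ⟨hla, hlb⟩ := (red l).1 (hne l (Or.inr rfl))
  obtain ⟨p, q, t, hi, hp, hq⟩ := exists_ofFn_eq_append i hkl
  have hk : List.ofFn (k.removeNth i) = p ++ (q ++ i l :: t) := by
    rw [ofFn_removeNth, hi, ← hp, eraseIdx_append_cons]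
  have hl : List.ofFn (l.removeNth i) = p ++ i k :: q ++ t := by
    rw [ofFn_removeNth, hi, ← hq, ← eraseIdx_append_cons (p ++ i k :: q) t (i l)]
    congr 1
    · simp
    · simp only [List.length_append, List.length_cons]
      omega
  have key := J.y_mul_y_eq (w := α ++ p ++ q ++ t) (v := α ++ j) (a := i k) (b := i l)
    (by
      rw [hl] at hla
      convert hla using 1
      simp only [sumEps_append, sumEps_cons]
      abel)
    (by
      rw [hk] at hka
      convert hka using 1
      simp only [sumEps_append, sumEps_cons]
      abel)
    (by
      convert hkb using 1
      simp only [sumEps_append, sumEps_cons]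
      abel)
    (by
      convert hlb using 1
      simp only [sumEps_append, sumEps_cons]
      abel)
    (by
      intro c γ hc hγ h1 h2
      -- The excess of w over v at c cannot come from the common part α, so c is the entry i_m of a
      -- third term; if both of its factors were nonzero, `h0` would fail.
      obtain ⟨m, hmk, hml, rfl⟩ : ∃ m, m ≠ k ∧ m ≠ l ∧ i m = c := by
        by_contra! h
        have h3 : sumEps (List.ofFn i) c = eps (i k) c + eps (i l) c := by
          rw [sumEps_ofFn, Finset.sum_apply]
          exact Fintype.sum_eq_add k l hkl.ne fun m hm => eps_of_ne (h m hm.1 hm.2)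
        rw [hi] at h3
        simp only [eps, sumEps_append, sumEps_cons, Pi.add_apply] at h3 hc
        omega
      refine (red m).2 ⟨?_, ?_⟩ (h0 m hmk hml)
      · convert h1 using 1
        apply add_right_cancel (b := eps (i m))
        rw [sumEps_append, add_assoc, sumEps_removeNth, hi, add_right_comm, add_right_comm γ, hγ]
        simp only [sumEps_append, sumEps_cons]
        abel
      · convert h2 using 1
        simp only [sumEps_append, sumEps_cons]
        abel)
  have e1 : J.y (α ++ List.ofFn (k.removeNth i)) =
      J.minusOne ^ t.length * J.y (α ++ p ++ q ++ t ++ [i l]) := by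
    rw [hk, ← y_move]
    simp
  have e2 : J.y (α ++ List.ofFn (l.removeNth i)) =
      J.minusOne ^ (q.length + t.length) * J.y (α ++ p ++ q ++ t ++ [i k]) := by
    have := J.y_move (α ++ p) (q ++ t) (i k)
    rw [List.length_append] at this
    rw [hl]
    simpa using this
  have e3 : J.minusOne ^ q.length * J.minusOne ^ q.length = 1 := by
    rw [← mul_pow, minusOne_mul_self, one_pow]
  -- Sign count: l = k + 1 + |q|, and moving i_k to the end passes |q| more entries than moving i_l.
  -- The two contributions of |q| cancel, and the remaining 1 cancels the leading minus sign.
  rw [e1, e2, J.y_move α j, J.y_move α j, ← hq, ← hp]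
  calc
    _ = J.minusOne ^ p.length * J.minusOne ^ t.length * J.minusOne ^ j.length *
        (J.y (α ++ p ++ q ++ t ++ [i l]) * J.y (α ++ j ++ [i k])) := by ac_rfl
    _ = (J.minusOne * J.minusOne) * (J.minusOne ^ q.length * J.minusOne ^ q.length) *
        (J.minusOne ^ p.length * J.minusOne ^ t.length * J.minusOne ^ j.length *
        (J.y (α ++ p ++ q ++ t ++ [i k]) * J.y (α ++ j ++ [i l]))) := by
      rw [e3, minusOne_mul_self, one_mul, one_mul, key]
    _ = _ := by
      rw [pow_add, pow_add, pow_add, pow_one]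
      ac_rfl

/-! ### Comparison of the two congruences and bijectivity -/

/-- It suffices to treat generators a ∼ b of the larger congruence, where a + (-b) is an alternating
relation or a Plücker relation whose nonzero terms are a and -b. -/
theorem quotientCon_relations_le :
    J.freeTract.quotientCon J.relations ≤ J.freeTract.quotientCon J.relations3 := by
  classical
  refine Con.conGen_le.2 fun a b hab => ?_
  by_cases ha : a = 0
  · have h := J.freeDegree_eq_of_mem hab
    rw [ha, map_zero, eq_comm, map_eq_zero] at h
    rw [ha, h]
    exact Con.refl _ _
  have hb : b ≠ 0 := by
    rintro rfl
    have h := J.freeDegree_eq_of_mem hab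
    rw [map_zero, map_eq_zero] at h
    exact ha h
  rcases hab with hab | ⟨s, α, i, j, -, -, -, -, hab⟩
  · exact ConGen.Rel.of _ _ (Or.inl hab)
  obtain ⟨k, -, hk, hab⟩ := exists_eq_of_sum_formal ha hab.symm
  -- The added 0 is the remainder after splitting off -b; it forces all further terms to vanish.
  rw [← add_zero (formal (J.freeTract.neg b))] at hab
  obtain ⟨l, hl, hlb, hab⟩ := exists_eq_of_sum_formal (Tract.neg_ne_zero hb) hab
  have hlk : l ≠ k := Finset.ne_of_mem_erase hl
  have hne : ∀ m, (m = k ∨ m = l) →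
      J.y (α ++ List.ofFn (m.removeNth i)) * J.y (α ++ i m :: j) ≠ 0 := by
    intro m hm
    rw [y, y, ← map_mul, map_ne_zero, Ne, ← signMul_eq_zero_iff _ ((-1) ^ (m : ℕ))]
    rcases hm with rfl | rfl
    · rwa [hk]
    · rw [hlb]
      exact Tract.neg_ne_zero hb
  have h0 : ∀ m, m ≠ k → m ≠ l →
      J.y (α ++ List.ofFn (m.removeNth i)) * J.y (α ++ i m :: j) = 0 := by
    intro m hmk hml
    rw [y, y, ← map_mul, map_eq_zero, ← signMul_eq_zero_iff _ ((-1) ^ (m : ℕ))]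
    exact eq_zero_of_sum_formal hab (by simp [hmk, hml])
  rw [← pastureProj_eq_iff, ← hk, ← J.freeTract.neg_neg b, ← hlb, pastureProj_neg,
    pastureProj_signMul, pastureProj_signMul, map_mul, map_mul]
  -- The position k of a may lie on either side of the position l of -b; the case l < k is the same
  -- equation multiplied by -1.
  rcases lt_or_gt_of_ne hlk with h | h
  · have := J.plucker_terms_eq α i j h (fun m hm => hne m hm.symm) fun m h1 h2 => h0 m h2 h1
    simp only [y] at this
    rw [this, ← mul_assoc J.minusOne, minusOne_mul_self, one_mul]
  · exact J.plucker_terms_eq α i j h hne h0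

theorem extComparison_bijective :
    Function.Bijective (fun a : J.extUniversalPasture => J.extComparison a) := by
  constructor
  · intro a b h
    induction a using Con.induction_on with
    | H a =>
      induction b using Con.induction_on with
      | H b => exact (Con.eq _).2 (J.quotientCon_relations_le ((Con.eq _).1 h))
  · intro b
    induction b using Con.induction_on with
    | H b => exact ⟨J.pastureProj b, rfl⟩

end Polymatroid

theorem theoremI {n r : ℕ} (J : Polymatroid n r) :
    Function.Bijective (fun a : J.extUniversalPasture => J.extComparison a) ∧
      Function.Bijective (fun a : J.universalPasture => J.comparison a) := by
  refine ⟨J.extComparison_bijective, fun a b h => ?_, fun b => ?_⟩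
  · exact Subtype.ext (J.extComparison_bijective.1 (congrArg Subtype.val h))
  · obtain ⟨a, ha⟩ := J.extComparison_bijective.2 b.1
    refine ⟨⟨a, ?_⟩, Subtype.ext ha⟩
    -- The comparison map preserves degrees, so a preimage of a degree 0 element has degree 0.
    change WithZero.log (J.degPasture a) = 0
    rw [← J.degTract_extComparison]
    exact (congrArg (fun c => WithZero.log (J.degTract c)) ha).trans b.2
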